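/- Let $n\ge 1$, $0<\rho<\infty$, $\lambda\in\mathbb C$, and consider $i\partial_t u+\Delta u=\lambda|u|^\rho u$, $u(0)=\phi$ on $\mathbb R\times\mathbb R^n$. Put $\alpha=\frac2\rho-\frac n{\rho+2}$ and $\beta=\frac2\rho-\frac{n(\rho+1)}{\rho+2}$. Let $S(t)$ be the Fourier multiplier with symbol $e^{-i|\xi|^2t}$ on tempered distributions, and for $1<p<\infty$ let $\|f\|_{(p,\infty)}=\sup_{t>0}t^{1/p}f^{**}(t)$ be the norm of the Marcinkiewicz space $L^{(p,\infty)}(\mathbb R^n)$, where $f^{**}(t)=\frac1t\int_0^tf^*(s)\,ds$ and $f^*$ is the decreasing rearrangement (the norm of a tempered distribution is $\infty$ if it is not a function). For $\gamma\in\mathbb R$ and $0<T\le\infty$ let $E(\gamma,T)$ be the space of all $u$ such that $|t|^{\gamma}u$ is bounded and continuous from $(-T,T)\setminus\{0\}$ to $L^{(\rho+2,\infty)}$ and $u$ is weakly continuous in the sense of distributions at $t=0$. Write $E_\alpha=E(\frac\alpha2,\infty)$, with norm $\|u\|_\alpha=\sup_{t\ne0}|t|^{\alpha/2}\|u(t)\|_{(\rho+2,\infty)}$,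 and $E^T_{\alpha,\beta}=E(\frac{\alpha-\beta}2,T)$. A mild solution with datum $\phi$ in such a space is an element $u$ of it with $$u(t)=S(t)\phi-i\lambda\int_0^tS(t-s)\big(|u(s)|^\rho u(s)\big)\,ds\qquad(0<|t|<T)$$ as tempered distributions (the integral being taken weakly, i.e. after pairing with Schwartz functions), and $u(t)\rightharpoonup\phi$ as $t\to0$ in the sense of distributions. (1) (Asymptotic stability.) Let $\frac{\rho+2}{\rho+1}<\frac{n\rho}2<\rho+2$ and $0\le h<1-\frac\alpha2(\rho+1)$. There is $\varepsilon_0>0$, depending only on $n,\rho,\lambda,h$, such that the following holds for every $0<\varepsilon\le\varepsilon_0$. Let $\phi,\varphi$ be tempered distributions with $\sup_{t\neq0}|t|^{\alpha/2}\|S(t)\phi\|_{(\rho+2,\infty)}<\varepsilon$ and $\sup_{t\ne0}|t|^{\alpha/2}\|S(t)\varphi\|_{(\rho+2,\infty)}<\varepsilon$, and let $u,v\in E_\alpha$ be mild solutions with data $\phi,\varphi$ and $\|u\|_\alpha,\|v\|_\alpha\le2\varepsilon$. If $$\lim_{|t|\to\infty}|t|^{\frac\alpha2+h}\|S(t)(\phi-\varphi)\|_{(\rho+2,\infty)}=0,\quad\text{then}\quad\lim_{|t|\to\infty}|t|^{\frac\alpha2+h}\|u(t)-v(t)\|_{(\rho+2,\infty)}=0.$$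 (2) (Behaviour as $t\to0$.) Let $\frac{n\rho}2<\frac{\rho+2}{\rho+1}$, put $\delta=1-\frac{\alpha-\beta}2(\rho+1)$ (which is then positive), and let $h>-\delta$. Let $\phi,\varphi\in L^{(\frac{\rho+2}{\rho+1},\infty)}$, let $0<T,T'\le\infty$, and let $u\in E^{T}_{\alpha,\beta}$ and $v\in E^{T'}_{\alpha,\beta}$ be mild solutions with data $\phi,\varphi$. If $$\lim_{t\to0}|t|^{\frac{\alpha-\beta}2-h}\|S(t)(\phi-\varphi)\|_{(\rho+2,\infty)}=0,\quad\text{then}\quad\lim_{t\to0}|t|^{\frac{\alpha-\beta}2-h}\|u(t)-v(t)\|_{(\rho+2,\infty)}=0.$$ -/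

import Mathlib

open MeasureTheory Filter Topology Set
open scoped ENNReal SchwartzMap FourierTransform

noncomputable section

namespace NLS

/-- The space `ℝⁿ` with its Euclidean norm. -/
abbrev Space (n : ℕ) : Type := EuclideanSpace ℝ (Fin n)

/-! ### Marcinkiewicz (weak Lebesgue) spaces `L^{(p,∞)}` -/

/-- The decreasing rearrangement `f*(t) = inf {s > 0 : m {x : |f x| > s} ≤ t}`. -/
def decRearr {n : ℕ} (f : Space n → ℂ) (t : ℝ≥0∞) : ℝ≥0∞ :=
  sInf {s : ℝ≥0∞ | 0 < s ∧ volume {x | s < ‖f x‖ₑ} ≤ t}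

/-- The averaged rearrangement `f**(t) = (1/t) ∫₀ᵗ f*(s) ds`. -/
def avgRearr {n : ℕ} (f : Space n → ℂ) (t : ℝ) : ℝ≥0∞ :=
  (ENNReal.ofReal t)⁻¹ * ∫⁻ s in Ioo 0 t, decRearr f (ENNReal.ofReal s)

/-- The norm `‖f‖_{(p,∞)} = sup_{t > 0} t^{1/p} f**(t)` of a function, with values in `[0,∞]`. -/
def weakNorm {n : ℕ} (p : ℝ) (f : Space n → ℂ) : ℝ≥0∞ :=
  ⨆ t : ℝ, ⨆ _ : 0 < t, ENNReal.ofReal (t ^ (1 / p)) * avgRearr f t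

/-- The tempered distribution `φ` is given by integration against the function `f`. -/
def Represents {n : ℕ} (φ : 𝓢'(Space n, ℂ)) (f : Space n → ℂ) : Prop :=
  ∀ ψ : 𝓢(Space n, ℂ), Integrable (fun x => f x * ψ x) ∧ φ ψ = ∫ x, f x * ψ x

/-- The norm `‖φ‖_{(p,∞)}` of a tempered distribution: the norm of the (almost everywhere unique)
measurable function representing it, and `∞` if there is no such function. -/
def distWeakNorm {n : ℕ} (p : ℝ) (φ : 𝓢'(Space n, ℂ)) : ℝ≥0∞ :=
  ⨅ f : Space n → ℂ, ⨅ _ : AEStronglyMeasurable f volume, ⨅ _ : Represents φ f, weakNorm p f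

/-- A tempered distribution belongs to `L^{(p,∞)}`. -/
def MemWeakLp {n : ℕ} (p : ℝ) (φ : 𝓢'(Space n, ℂ)) : Prop :=
  ∃ f : Space n → ℂ, AEStronglyMeasurable f volume ∧ Represents φ f ∧ weakNorm p f < ∞

/-! ### The linear Schrödinger group -/

/-- The symbol of `S(t)`. Mathlib's Fourier transform has the kernel `e^{-2πi x·ξ}`, so the
multiplier `e^{-i|ξ|²t}` reads `e^{-i|2πξ|²t}` in its frequency variable. -/
def symbol (n : ℕ) (t : ℝ) (ξ : Space n) : ℂ :=
  Complex.exp (((-(t * (2 * Real.pi) ^ 2)) * ‖ξ‖ ^ 2 : ℝ) * Complex.I)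

/-- `S(t)` on Schwartz functions. -/
def schrodinger {n : ℕ} (t : ℝ) : 𝓢(Space n, ℂ) →L[ℂ] 𝓢(Space n, ℂ) :=
  SchwartzMap.fourierMultiplierCLM ℂ (symbol n t)

/-- `S(t)` on tempered distributions. -/
def distSchrodinger {n : ℕ} (t : ℝ) : 𝓢'(Space n, ℂ) →L[ℂ] 𝓢'(Space n, ℂ) :=
  TemperedDistribution.fourierMultiplierCLM ℂ (symbol n t)

theorem hasTemperateGrowth_exp_mul_I :
    (fun r : ℝ => Complex.exp (r * Complex.I)).HasTemperateGrowth := by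
  refine ⟨(Complex.ofRealCLM.contDiff.mul contDiff_const).cexp, fun k => ⟨0, 1, fun x => ?_⟩⟩
  rw [norm_iteratedFDeriv_eq_norm_iteratedDeriv]
  have h : ∀ k : ℕ, iteratedDeriv k (fun r : ℝ => Complex.exp (r * Complex.I))
      = fun r : ℝ => Complex.I ^ k * Complex.exp (r * Complex.I) := by
    intro k
    induction k with
    | zero => ext; simp
    | succ k ih =>
      rw [iteratedDeriv_succ, ih]
      ext r
      have h1 : HasDerivAt (fun r : ℝ => (r : ℂ) * Complex.I) (1 * Complex.I) r :=
        (Complex.ofRealCLM.hasDerivAt).mul_const _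
      rw [((h1.cexp).const_mul _).deriv]; ring
  rw [h]
  simp [Complex.norm_exp_ofReal_mul_I]

/-- The symbol is an admissible Fourier multiplier on `𝓢` and `𝓢'`. -/
theorem hasTemperateGrowth_symbol (n : ℕ) (t : ℝ) : (symbol n t).HasTemperateGrowth := by
  have h : (fun ξ : Space n => -(t * (2 * Real.pi) ^ 2) * ‖ξ‖ ^ 2).HasTemperateGrowth :=
    (Function.HasTemperateGrowth.const _).mul (Function.hasTemperateGrowth_norm_sq _)
  exact hasTemperateGrowth_exp_mul_I.comp h

/-- `S(t)` on tempered distributions is the transpose of `S(t)` on Schwartz functions for the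
bilinear pairing. -/
theorem distSchrodinger_apply {n : ℕ} (t : ℝ) (φ : 𝓢'(Space n, ℂ)) (ψ : 𝓢(Space n, ℂ)) :
    distSchrodinger t φ ψ = φ (schrodinger t ψ) := by
  rw [distSchrodinger, TemperedDistribution.fourierMultiplierCLM_apply_apply, schrodinger,
    SchwartzMap.fourierMultiplierCLM_apply]
  congr 1
  have hs := hasTemperateGrowth_symbol n t
  ext x
  rw [SchwartzMap.fourier_coe, SchwartzMap.fourierInv_coe, Real.fourierInv_eq_fourier_neg,
    Real.fourier_eq, Real.fourier_eq]
  rw [← integral_neg_eq_self]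
  congr 1
  ext ξ
  simp only [SchwartzMap.smulLeftCLM_apply_apply hs, SchwartzMap.fourier_coe,
    SchwartzMap.fourierInv_coe, Real.fourierInv_eq_fourier_neg, neg_neg, inner_neg_left,
    inner_neg_right]
  simp [symbol]
/-! ### Exponents, solution spaces and mild solutions -/

/-- `α = 2/ρ - n/(ρ+2)`. -/
def alpha (n : ℕ) (ρ : ℝ) : ℝ := 2 / ρ - n / (ρ + 2)

/-- `β = 2/ρ - n(ρ+1)/(ρ+2)`. -/
def beta (n : ℕ) (ρ : ℝ) : ℝ := 2 / ρ - n * (ρ + 1) / (ρ + 2)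

/-- The punctured time interval `(-T,T) \ {0}`, for `0 < T ≤ ∞`. -/
def times (T : ℝ≥0∞) : Set ℝ := {t | t ≠ 0 ∧ ENNReal.ofReal |t| < T}

/-- The norm `sup_{0 < |t| < T} |t|^γ ‖u(t)‖_{(p,∞)}`. -/
def spaceNorm {n : ℕ} (p γ : ℝ) (T : ℝ≥0∞) (u : ℝ → Space n → ℂ) : ℝ≥0∞ :=
  ⨆ t ∈ times T, ENNReal.ofReal (|t| ^ γ) * weakNorm p (u t)

/-- The space of all `u` such that `|t|^γ u` is bounded and norm continuous from `(-T,T) \ {0}` to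
`L^{(p,∞)}` and `u` is weakly continuous in the sense of distributions at `t = 0`.
The spaces `E_α` and `E_{α,β}^T` are the cases `γ = α/2`, `T = ∞` and `γ = (α-β)/2`,
with `p = ρ + 2`. -/
structure MemSpace {n : ℕ} (p γ : ℝ) (T : ℝ≥0∞) (u : ℝ → Space n → ℂ) : Prop where
  aestronglyMeasurable : ∀ t ∈ times T, AEStronglyMeasurable (u t) volume
  bounded : spaceNorm p γ T u < ∞
  continuous : ∀ t₀ ∈ times T, Tendsto
    (fun t => weakNorm p (fun x => ((|t| ^ γ : ℝ) : ℂ) * u t x - ((|t₀| ^ γ : ℝ) : ℂ) * u t₀ x))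
    (𝓝 t₀) (𝓝 0)
  weak_continuous_zero : ∀ ψ : 𝓢(Space n, ℂ), HasCompactSupport ψ →
    ∃ c : ℂ, Tendsto (fun t => ∫ x, u t x * ψ x) (𝓝[≠] 0) (𝓝 c)

/-- The pairing `⟨S(t-s)(|u(s)|^ρ u(s)), ψ⟩`, that is `⟨|u(s)|^ρ u(s), S(t-s)ψ⟩`. -/
def duhamelPairing {n : ℕ} (ρ : ℝ) (u : ℝ → Space n → ℂ) (t s : ℝ) (ψ : 𝓢(Space n, ℂ)) : ℂ :=
  ∫ x, (((‖u s x‖ ^ ρ : ℝ) : ℂ) * u s x) * schrodinger (t - s) ψ x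

/-- A mild solution `u` of `i ∂ₜu + Δu = λ|u|^ρ u`, `u(0) = φ`, in the space with weight `|t|^γ` on
`(-T,T)`. The equation `u(t) = S(t)φ - iλ ∫₀ᵗ S(t-s)(|u(s)|^ρ u(s)) ds` is an identity of tempered
distributions with a weakly defined integral, for all `0 < |t| < T`. -/
structure IsMildSolution {n : ℕ} (ρ : ℝ) (lam : ℂ) (γ : ℝ) (T : ℝ≥0∞) (φ : 𝓢'(Space n, ℂ))
    (u : ℝ → Space n → ℂ) : Prop where
  mem : MemSpace (ρ + 2) γ T u
  duhamel_integrable : ∀ t ∈ times T, ∀ ψ : 𝓢(Space n, ℂ),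
    IntervalIntegrable (fun s => duhamelPairing ρ u t s ψ) volume 0 t
  integral_equation : ∀ t ∈ times T, ∀ ψ : 𝓢(Space n, ℂ),
    ∫ x, u t x * ψ x
      = distSchrodinger t φ ψ - Complex.I * lam * ∫ s in (0 : ℝ)..t, duhamelPairing ρ u t s ψ
  initial : ∀ ψ : 𝓢(Space n, ℂ), HasCompactSupport ψ →
    Tendsto (fun t => ∫ x, u t x * ψ x) (𝓝[≠] 0) (𝓝 (φ ψ))

/-- `u` is the global solution with small datum `φ`: the linear evolution of `φ` satisfies
`sup_{t ≠ 0} |t|^{α/2} ‖S(t)φ‖_{(ρ+2,∞)} < ε`, and `u ∈ E_α` is a mild solution with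
`‖u‖_α ≤ 2ε`. -/
structure IsSmallGlobalSolution {n : ℕ} (ρ : ℝ) (lam : ℂ) (ε : ℝ) (φ : 𝓢'(Space n, ℂ))
    (u : ℝ → Space n → ℂ) : Prop where
  small : (⨆ t : ℝ, ⨆ _ : t ≠ 0, ENNReal.ofReal (|t| ^ (alpha n ρ / 2)) *
    distWeakNorm (ρ + 2) (distSchrodinger t φ)) < ENNReal.ofReal ε
  mild : IsMildSolution ρ lam (alpha n ρ / 2) ∞ φ u
  norm_le : spaceNorm (ρ + 2) (alpha n ρ / 2) ∞ u ≤ ENNReal.ofReal (2 * ε)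

/-- `u ∈ E_{α,β}^T` is a local mild solution with datum `φ ∈ L^{((ρ+2)/(ρ+1),∞)}`. -/
structure IsLocalSolution {n : ℕ} (ρ : ℝ) (lam : ℂ) (T : ℝ≥0∞) (φ : 𝓢'(Space n, ℂ))
    (u : ℝ → Space n → ℂ) : Prop where
  datum : MemWeakLp ((ρ + 2) / (ρ + 1)) φ
  mild : IsMildSolution ρ lam ((alpha n ρ - beta n ρ) / 2) T φ u

end NLS

end

noncomputable section


namespace NLS

/-! Put `p = ρ + 2`, `q = (ρ + 2) / (ρ + 1)` (the conjugate exponent) and `σ = decayExp n ρ`.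
Interpolating the dispersive bound `L¹ → L^∞` with unitarity on `L²` gives `S(t) : L^{(q,∞)} →
L^{(p,∞)}` with norm `C |t|^{-σ}`, and by Hölder `|u|^ρ u` is locally Lipschitz from `L^{(p,∞)}` to
`L^{(q,∞)}`. So if `u` and `v` are `O(|t|^{-κ})`, the size `d(t)` of `u(t) - v(t)` is controlled by
the linear part plus a constant times `∫ |t-s|^{-σ} |s|^{-κρ} d(s) ds`. This integral turns a power
`|s|^{-μ}` into `|t|^{1-σ-κρ-μ}` times a Beta integral, which converges when `σ < 1` and `κρ + μ <
1`.

For global solutions `κ = α/2` and `σ + κρ = 1`: the power is preserved and small data make the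
factor less than one. Iteration bounds the weighted difference uniformly, then improves the bound
geometrically as `|t| → ∞`, because the times `|s| ≤ R` contribute with a faster decay in `t`. For
local solutions `κ = σ`, and each iteration gains `|t|^δ` with `δ = 1 - σ(ρ+1) > 0`. No smallness is
needed: finitely many steps reach the exponent `h`, and one more makes the Duhamel term negligible.

The weak equation enters only through pairings with Schwartz functions.
`DistrBound.norm_integral_mul_schrodinger_le` bounds them for test functions resembling the
indicator of a set of measure `e`, and `distrBound_of_pairing` recovers the weak bound by duality.
`IsMildSolution.distrBound_sub` combines these into the integral inequality, where only power bounds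
at each time are propagated. -/

/-! ### Distribution function bounds -/

/-- The distribution function of `f` is at most `(A/s)^p`. -/
def DistrBound {n : ℕ} (p A : ℝ) (f : Space n → ℂ) : Prop :=
  ∀ s : ℝ, 0 < s → volume {x | s < ‖f x‖} ≤ ENNReal.ofReal ((A / s) ^ p)

theorem DistrBound.mono {n : ℕ} {p A B : ℝ} {f : Space n → ℂ} (hp : 0 ≤ p) (hA : 0 ≤ A)
    (hAB : A ≤ B) (h : DistrBound p A f) : DistrBound p B f := fun s hs =>
  (h s hs).trans (ENNReal.ofReal_le_ofReal
    (Real.rpow_le_rpow (by positivity) (by gcongr) hp))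

/-- One of the summands exceeds half the level, and `a^p + b^p ≤ (a+b)^p` for `p ≥ 1`. The factor 2
is the price of working with distribution functions, which give only a quasi-norm; it recurs in the
later constants. -/
theorem DistrBound.add {n : ℕ} {p A B : ℝ} {f g : Space n → ℂ} (hp : 1 ≤ p) (hA : 0 ≤ A)
    (hB : 0 ≤ B) (hf : DistrBound p A f) (hg : DistrBound p B g) :
    DistrBound p (2 * (A + B)) (fun x => f x + g x) := by
  intro s hs
  have hsub : {x | s < ‖f x + g x‖} ⊆ {x | s / 2 < ‖f x‖} ∪ {x | s / 2 < ‖g x‖} := by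
    intro x hx
    by_contra hcon
    simp only [mem_union, mem_ofPred_eq, not_or, not_lt] at hcon hx
    have := norm_add_le (f x) (g x)
    linarith
  calc volume {x | s < ‖f x + g x‖}
      ≤ ENNReal.ofReal ((A / (s / 2)) ^ p) + ENNReal.ofReal ((B / (s / 2)) ^ p) :=
        (measure_mono hsub).trans ((measure_union_le _ _).trans
          (add_le_add (hf _ (by positivity)) (hg _ (by positivity))))
    _ = ENNReal.ofReal ((A / (s / 2)) ^ p + (B / (s / 2)) ^ p) :=
        (ENNReal.ofReal_add (by positivity) (by positivity)).symm
    _ ≤ ENNReal.ofReal ((2 * (A + B) / s) ^ p) := by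
        refine ENNReal.ofReal_le_ofReal ?_
        have := Real.add_rpow_le_rpow_add (a := A / (s / 2)) (b := B / (s / 2)) (by positivity)
          (by positivity) hp
        refine this.trans (le_of_eq ?_)
        congr 1
        field_simp

theorem DistrBound.neg {n : ℕ} {p A : ℝ} {f : Space n → ℂ} (hf : DistrBound p A f) :
    DistrBound p A (fun x => -f x) := by
  simpa only [DistrBound, norm_neg] using hf

theorem DistrBound.sub {n : ℕ} {p A B : ℝ} {f g : Space n → ℂ} (hp : 1 ≤ p) (hA : 0 ≤ A)
    (hB : 0 ≤ B) (hf : DistrBound p A f) (hg : DistrBound p B g) :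
    DistrBound p (2 * (A + B)) (fun x => f x - g x) := by
  simpa only [sub_eq_add_neg] using hf.add hp hA hB hg.neg

theorem decRearr_antitone {n : ℕ} (f : Space n → ℂ) : Antitone (decRearr f) :=
  fun _ _ hst => sInf_le_sInf fun _ h => ⟨h.1, h.2.trans hst⟩

theorem decRearr_le_avgRearr {n : ℕ} (f : Space n → ℂ) {t : ℝ} (ht : 0 < t) :
    decRearr f (ENNReal.ofReal t) ≤ avgRearr f t := by
  have h1 : ∫⁻ _ in Ioo 0 t, decRearr f (ENNReal.ofReal t)
      ≤ ∫⁻ s in Ioo 0 t, decRearr f (ENNReal.ofReal s) :=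
    setLIntegral_mono' measurableSet_Ioo fun s hs =>
      decRearr_antitone f (ENNReal.ofReal_le_ofReal hs.2.le)
  have ht0 : ENNReal.ofReal t ≠ 0 := by simpa using ht
  rw [setLIntegral_const, Real.volume_Ioo, sub_zero, mul_comm] at h1
  unfold avgRearr
  refine le_trans (le_of_eq ?_) (mul_le_mul_right h1 _)
  rw [← mul_assoc, ENNReal.inv_mul_cancel ht0 ENNReal.ofReal_ne_top, one_mul]

theorem setOf_ofReal_lt_enorm {n : ℕ} (f : Space n → ℂ) {s : ℝ} (hs : 0 ≤ s) :
    {x | ENNReal.ofReal s < ‖f x‖ₑ} = {x | s < ‖f x‖} := by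
  ext x
  simp only [mem_ofPred_eq, ← ofReal_norm]
  exact ENNReal.ofReal_lt_ofReal_iff_of_nonneg hs

/-- Since `f* ≤ f**`, any `r > (A/s)^p` satisfies `f*(r) ≤ A r^{-1/p} < s`, so the level set at `s`
has measure at most `r`. Then `r` decreases to `(A/s)^p`. -/
theorem distrBound_of_weakNorm_le {n : ℕ} {p A : ℝ} {f : Space n → ℂ} (hp : 0 < p) (hA : 0 ≤ A)
    (h : weakNorm p f ≤ ENNReal.ofReal A) : DistrBound p A f := by
  intro s hs
  refine le_of_forall_gt_imp_ge_of_dense fun r hr => ?_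
  rcases eq_or_ne r ∞ with rfl | hr'
  · exact le_top
  lift r to NNReal using hr'
  have hr0 : (A / s) ^ p < (r : ℝ) := by
    rw [← ENNReal.ofReal_coe_nnreal] at hr
    exact (ENNReal.ofReal_lt_ofReal_iff_of_nonneg (by positivity)).1 hr
  have hrpos : (0 : ℝ) < r := lt_of_le_of_lt (by positivity) hr0
  have h1 : ENNReal.ofReal ((r : ℝ) ^ (1 / p)) * decRearr f (ENNReal.ofReal r)
      ≤ ENNReal.ofReal A :=
    (mul_le_mul_right (decRearr_le_avgRearr f hrpos) _).trans ((le_iSup₂ (f := fun (t : ℝ)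
      (_ : 0 < t) => ENNReal.ofReal (t ^ (1 / p)) * avgRearr f t) (r : ℝ) hrpos).trans h)
  have h2 : decRearr f (ENNReal.ofReal r) < ENNReal.ofReal s := by
    by_contra hcon
    rw [not_lt] at hcon
    have h3 := (mul_le_mul_right hcon _).trans h1
    rw [← ENNReal.ofReal_mul (by positivity), ENNReal.ofReal_le_ofReal_iff hA] at h3
    have h4 : (r : ℝ) ^ (1 / p) ≤ A / s := by rwa [le_div_iff₀ hs]
    have h5 := Real.rpow_le_rpow (by positivity) h4 hp.le
    rw [← Real.rpow_mul hrpos.le, one_div_mul_cancel hp.ne', Real.rpow_one] at h5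
    linarith
  obtain ⟨s', ⟨_, hs'⟩, hlt⟩ := sInf_lt_iff.1 h2
  rw [ENNReal.ofReal_coe_nnreal] at hs'
  refine le_trans (measure_mono ?_) hs'
  rw [← setOf_ofReal_lt_enorm f hs.le]
  exact fun x hx => hlt.trans hx

/-- The factor `p/(p-1)` comes from averaging `s^{-1/p}` over `(0,t)`, which is where `p > 1`
matters. -/
theorem DistrBound.weakNorm_le {n : ℕ} {p A : ℝ} {f : Space n → ℂ} (hp : 1 < p) (hA : 0 < A)
    (h : DistrBound p A f) : weakNorm p f ≤ ENNReal.ofReal (p / (p - 1) * A) := by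
  have hp0 : 0 < p := by linarith
  have h1p : 1 / p < 1 := by rw [div_lt_one hp0]; exact hp
  have hdec : ∀ t : ℝ, 0 < t → decRearr f (ENNReal.ofReal t)
      ≤ ENNReal.ofReal (A * t ^ (-(1 / p))) := by
    intro t ht
    have hpos : 0 < A * t ^ (-(1 / p)) := by positivity
    refine sInf_le ⟨by simpa using hpos, ?_⟩
    rw [setOf_ofReal_lt_enorm f hpos.le]
    refine (h _ hpos).trans (le_of_eq ?_)
    congr 1
    rw [Real.rpow_neg ht.le, ← div_div, div_self hA.ne', one_div, inv_inv, ← Real.rpow_mul ht.le,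
      one_div_mul_cancel hp0.ne', Real.rpow_one]
  refine iSup₂_le fun t ht => ?_
  have hint : IntegrableOn (fun s : ℝ => A * s ^ (-(1 / p))) (Ioo 0 t) := by
    refine Integrable.const_mul ?_ _
    have := (intervalIntegral.intervalIntegrable_rpow' (a := 0) (b := t) (r := -(1 / p))
      (by linarith))
    rw [intervalIntegrable_iff_integrableOn_Ioo_of_le ht.le] at this
    exact this
  have hval : ∫ s in Ioo 0 t, A * s ^ (-(1 / p)) = A * (t ^ (1 - 1 / p) / (1 - 1 / p)) := by
    rw [integral_const_mul, ← integral_Ioc_eq_integral_Ioo,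
      ← intervalIntegral.integral_of_le ht.le, integral_rpow (Or.inl (by linarith))]
    rw [show -(1 / p) + 1 = 1 - 1 / p by ring, Real.zero_rpow (by linarith), sub_zero]
  have h2 : ∫⁻ s in Ioo 0 t, decRearr f (ENNReal.ofReal s)
      ≤ ENNReal.ofReal (A * (t ^ (1 - 1 / p) / (1 - 1 / p))) := by
    rw [← hval, ofReal_integral_eq_lintegral_ofReal hint
      ((ae_restrict_mem measurableSet_Ioo).mono fun s hs => by
        have := hs.1; simp only [Pi.zero_apply]; positivity)]
    exact setLIntegral_mono' measurableSet_Ioo fun s hs => hdec s hs.1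
  unfold avgRearr
  refine (mul_le_mul_right (mul_le_mul_right h2 _) _).trans (le_of_eq ?_)
  rw [← ENNReal.ofReal_inv_of_pos ht, ← ENNReal.ofReal_mul (by positivity),
    ← ENNReal.ofReal_mul (by positivity)]
  congr 1
  rw [Real.rpow_sub ht, Real.rpow_one]
  have : p - 1 ≠ 0 := by linarith
  have h3 : t ^ (1 / p) ≠ 0 := by positivity
  field_simp

/-- Weak Hölder inequality: where the product is large, `f` exceeds `a` or `g` exceeds `s / a^ρ`,
for any cut `a`. -/
theorem DistrBound.mul_rpow {n : ℕ} {ρ A D : ℝ} {f g : Space n → ℂ} (hρ : 0 < ρ) (hA : 0 < A)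
    (hD : 0 < D) (hf : DistrBound (ρ + 2) A f) (hg : DistrBound (ρ + 2) D g) {F : Space n → ℂ}
    (hF : ∀ x, ‖F x‖ ≤ ‖f x‖ ^ ρ * ‖g x‖) :
    DistrBound ((ρ + 2) / (ρ + 1)) (2 * (A ^ ρ * D)) F := by
  intro s hs
  -- This cut gives both level sets the same bound, as `A/a = D/(s/a^ρ)`.
  set a : ℝ := (A * s / D) ^ (1 / (ρ + 1)) with ha
  have ha0 : 0 < a := by positivity
  have hapow : a ^ ρ * a = A * s / D := by
    rw [← Real.rpow_add_one ha0.ne', ha, ← Real.rpow_mul (by positivity),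
      one_div_mul_cancel (by positivity), Real.rpow_one]
  have hsub : {x | s < ‖F x‖} ⊆ {x | a < ‖f x‖} ∪ {x | s / a ^ ρ < ‖g x‖} := by
    intro x hx
    by_contra hcon
    simp only [mem_union, mem_ofPred_eq, not_or, not_lt] at hcon hx
    have h1 : ‖f x‖ ^ ρ * ‖g x‖ ≤ a ^ ρ * (s / a ^ ρ) :=
      mul_le_mul (Real.rpow_le_rpow (norm_nonneg _) hcon.1 hρ.le) hcon.2 (norm_nonneg _)
        (by positivity)
    rw [mul_div_cancel₀ _ (by positivity)] at h1
    linarith [hF x]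
  have e1 : D / (s / a ^ ρ) = A / a := by
    have : a ^ ρ = A * s / D / a := by rw [← hapow]; field_simp
    rw [this]; field_simp
  have e2 : (A / a) ^ (ρ + 2) = (A ^ ρ * D / s) ^ ((ρ + 2) / (ρ + 1)) := by
    have : A / a = (A ^ ρ * D / s) ^ (1 / (ρ + 1)) := by
      have hA' : A = (A ^ (ρ + 1)) ^ (1 / (ρ + 1)) := by
        rw [← Real.rpow_mul hA.le, mul_one_div_cancel (by positivity), Real.rpow_one]
      rw [ha]
      nth_rewrite 1 [hA']
      rw [← Real.div_rpow (by positivity) (by positivity), Real.rpow_add_one hA.ne']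
      congr 1
      field_simp
    rw [this, ← Real.rpow_mul (by positivity)]
    congr 1
    ring
  calc volume {x | s < ‖F x‖}
      ≤ ENNReal.ofReal ((A / a) ^ (ρ + 2)) + ENNReal.ofReal ((D / (s / a ^ ρ)) ^ (ρ + 2)) :=
        (measure_mono hsub).trans ((measure_union_le _ _).trans
          (add_le_add (hf _ (by positivity)) (hg _ (by positivity))))
    _ = ENNReal.ofReal (2 * (A ^ ρ * D / s) ^ ((ρ + 2) / (ρ + 1))) := by
        rw [e1, e2, ← ENNReal.ofReal_add (by positivity) (by positivity), two_mul]
    _ ≤ ENNReal.ofReal ((2 * (A ^ ρ * D) / s) ^ ((ρ + 2) / (ρ + 1))) := by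
        refine ENNReal.ofReal_le_ofReal ?_
        have hq : (1 : ℝ) ≤ (ρ + 2) / (ρ + 1) := by rw [le_div_iff₀ (by positivity)]; linarith
        have hle := Real.rpow_le_rpow_of_exponent_le (x := 2) (by norm_num) hq
        rw [Real.rpow_one] at hle
        have hnn : 0 ≤ A ^ ρ * D / s := by positivity
        rw [mul_div_assoc 2 (A ^ ρ * D) s, Real.mul_rpow (by norm_num) hnn]
        exact mul_le_mul_of_nonneg_right hle (by positivity)

/-! ### Truncation -/

/-- With the next truncation bound this makes `L^{(q,∞)} ⊂ L¹ + L²` quantitative for `1 < q < 2`: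
the layer-cake integral converges at infinity because `q > 1`. -/
theorem lintegral_truncation_large_le {n : ℕ} {q A M : ℝ} {f : Space n → ℂ} (hq : 1 < q)
    (hA : 0 < A) (hM : 0 < M) (hfm : AEStronglyMeasurable f volume) (hf : DistrBound q A f) :
    ∫⁻ x, ENNReal.ofReal (if M < ‖f x‖ then ‖f x‖ else 0)
      ≤ ENNReal.ofReal (q / (q - 1) * (A ^ q * M ^ (1 - q))) := by
  have hm : AEMeasurable (fun x => if M < ‖f x‖ then ‖f x‖ else 0) volume := by
    have h1 : Measurable fun r : ℝ => if M < r then r else 0 :=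
      Measurable.ite measurableSet_Ioi measurable_id measurable_const
    exact h1.comp_aemeasurable hfm.norm.aemeasurable
  have hnn : ∀ x, 0 ≤ (if M < ‖f x‖ then ‖f x‖ else 0) := fun x => by split_ifs <;> simp
  rw [lintegral_eq_lintegral_meas_lt volume (Eventually.of_forall hnn) hm]
  have hset : ∀ s : ℝ, 0 < s → volume {x | s < if M < ‖f x‖ then ‖f x‖ else 0}
      ≤ ENNReal.ofReal ((A / max s M) ^ q) := fun s hs => by
    refine le_trans (measure_mono fun x hx => ?_) (hf _ (lt_max_of_lt_left hs))
    simp only [mem_ofPred_eq] at hx ⊢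
    split_ifs at hx with h
    · exact max_lt hx h
    · linarith
  have hsplit : Ioi (0 : ℝ) = Ioc 0 M ∪ Ioi M := (Ioc_union_Ioi_eq_Ioi hM.le).symm
  have hint : IntegrableOn (fun s : ℝ => A ^ q * s ^ (-q)) (Ioi M) :=
    (integrableOn_Ioi_rpow_of_lt (by linarith) hM).const_mul _
  calc ∫⁻ s in Ioi 0, volume {x | s < if M < ‖f x‖ then ‖f x‖ else 0}
      ≤ ∫⁻ s in Ioi 0, ENNReal.ofReal ((A / max s M) ^ q) :=
        setLIntegral_mono' measurableSet_Ioi hset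
    _ ≤ (∫⁻ s in Ioc 0 M, ENNReal.ofReal ((A / max s M) ^ q))
        + ∫⁻ s in Ioi M, ENNReal.ofReal ((A / max s M) ^ q) := by
        rw [hsplit]; exact lintegral_union_le _ _ _
    _ = ENNReal.ofReal ((A / M) ^ q * M) + ENNReal.ofReal (A ^ q * (M ^ (1 - q) / (q - 1))) := by
        congr 1
        · rw [setLIntegral_congr_fun (g := fun _ => ENNReal.ofReal ((A / M) ^ q))
            measurableSet_Ioc fun s hs => by simp only [max_eq_right hs.2], setLIntegral_const,
            Real.volume_Ioc, sub_zero, ← ENNReal.ofReal_mul (by positivity)]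
        · rw [setLIntegral_congr_fun (g := fun s => ENNReal.ofReal (A ^ q * s ^ (-q)))
            measurableSet_Ioi fun s hs => by
              have hs' : M < s := hs
              have hs0 : 0 < s := hM.trans hs'
              simp only [max_eq_left hs'.le]
              rw [Real.div_rpow hA.le hs0.le, Real.rpow_neg hs0.le, div_eq_mul_inv],
            ← ofReal_integral_eq_lintegral_ofReal hint
              ((ae_restrict_mem measurableSet_Ioi).mono fun s hs => by
                have hs0 : 0 < s := hM.trans hs
                simp only [Pi.zero_apply]; positivity),
            integral_const_mul, integral_Ioi_rpow_of_lt (by linarith) hM]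
          congr 2
          rw [show -q + 1 = 1 - q by ring, show 1 - q = -(q - 1) by ring, neg_div_neg_eq]
    _ = ENNReal.ofReal (q / (q - 1) * (A ^ q * M ^ (1 - q))) := by
        have hq1 : 0 < q - 1 := by linarith
        rw [← ENNReal.ofReal_add (by positivity) (by positivity)]
        congr 1
        rw [Real.div_rpow hA.le hM.le, Real.rpow_sub hM, Real.rpow_one]
        field_simp
        ring

/-- The part below the height `M` is square integrable: the weight `s` tames the layer-cake integral
at zero because `q < 2`. -/
theorem lintegral_truncation_small_le {n : ℕ} {q A M : ℝ} {f : Space n → ℂ} (hq : q < 2) (hA : 0 < A) (hM : 0 < M) (hfm : AEStronglyMeasurable f volume)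
    (hf : DistrBound q A f) :
    ∫⁻ x, ENNReal.ofReal (if M < ‖f x‖ then 0 else ‖f x‖ ^ 2)
      ≤ ENNReal.ofReal (2 / (2 - q) * (A ^ q * M ^ (2 - q))) := by
  set F : Space n → ℝ := fun x => if M < ‖f x‖ then 0 else ‖f x‖ with hF
  have hm : AEMeasurable F volume := by
    have h1 : Measurable fun r : ℝ => if M < r then 0 else r :=
      Measurable.ite measurableSet_Ioi measurable_const measurable_id
    exact h1.comp_aemeasurable hfm.norm.aemeasurable
  have hnn : ∀ x, 0 ≤ F x := fun x => by simp only [hF]; split_ifs <;> simp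
  have hset : ∀ s : ℝ, 0 < s → volume {x | s < F x} ≤ ENNReal.ofReal ((A / s) ^ q) :=
    fun s hs => by
      refine le_trans (measure_mono fun x hx => ?_) (hf _ hs)
      simp only [mem_ofPred_eq, hF] at hx ⊢
      split_ifs at hx with h
      · linarith
      · exact hx
  have hset' : ∀ s : ℝ, M < s → volume {x | s < F x} = 0 := fun s hs => by
    convert measure_empty (μ := (volume : Measure (Space n)))
    ext x
    simp only [mem_ofPred_eq, hF, mem_empty_iff_false, iff_false, not_lt]
    split_ifs with h <;> linarith
  have hlhs : ∫⁻ x, ENNReal.ofReal (if M < ‖f x‖ then 0 else ‖f x‖ ^ 2)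
      = ∫⁻ x, ENNReal.ofReal (F x ^ (2 : ℝ)) := by
    refine lintegral_congr fun x => ?_
    simp only [hF]
    split_ifs <;> simp
  have hint : IntegrableOn (fun s : ℝ => A ^ q * s ^ (1 - q)) (Ioc 0 M) := by
    refine Integrable.const_mul ?_ _
    have := (intervalIntegral.intervalIntegrable_rpow' (a := 0) (b := M) (r := 1 - q)
      (by linarith))
    rwa [intervalIntegrable_iff_integrableOn_Ioc_of_le hM.le] at this
  have hsplit : Ioi (0 : ℝ) = Ioc 0 M ∪ Ioi M := (Ioc_union_Ioi_eq_Ioi hM.le).symm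
  rw [hlhs, lintegral_rpow_eq_lintegral_meas_lt_mul volume (Eventually.of_forall hnn) hm
    two_pos]
  have h1 : ∫⁻ s in Ioi 0, volume {x | s < F x} * ENNReal.ofReal (s ^ ((2 : ℝ) - 1))
      ≤ ENNReal.ofReal (A ^ q * (M ^ (2 - q) / (2 - q))) := by
    rw [hsplit]
    refine (lintegral_union_le _ _ _).trans ?_
    rw [setLIntegral_congr_fun (s := Ioi M) (g := fun _ => 0) measurableSet_Ioi
      fun s hs => by simp only [hset' s hs, zero_mul], lintegral_zero, add_zero]
    have hval : ∫ s in Ioc 0 M, A ^ q * s ^ (1 - q) = A ^ q * (M ^ (2 - q) / (2 - q)) := by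
      rw [integral_const_mul, ← intervalIntegral.integral_of_le hM.le,
        integral_rpow (Or.inl (by linarith)), show 1 - q + 1 = 2 - q by ring,
        Real.zero_rpow (by linarith), sub_zero]
    rw [← hval, ofReal_integral_eq_lintegral_ofReal hint
      ((ae_restrict_mem measurableSet_Ioc).mono fun s hs => by
        have := hs.1; simp only [Pi.zero_apply]; positivity)]
    refine setLIntegral_mono' measurableSet_Ioc fun s hs => ?_
    refine (mul_le_mul_left (hset s hs.1) _).trans (le_of_eq ?_)
    have hs0 := hs.1
    rw [← ENNReal.ofReal_mul (by positivity), Real.div_rpow hA.le hs0.le,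
      show (2 : ℝ) - 1 = 1 by norm_num, Real.rpow_one, Real.rpow_sub hs0, Real.rpow_one]
    congr 1
    field_simp
  refine (mul_le_mul_right h1 _).trans (le_of_eq ?_)
  rw [← ENNReal.ofReal_mul (by norm_num)]
  congr 1
  ring

/-! ### The dispersive estimate -/

theorem norm_symbol (n : ℕ) (t : ℝ) (ξ : Space n) : ‖symbol n t ξ‖ = 1 := by
  rw [symbol, Complex.norm_exp_ofReal_mul_I]

theorem schrodinger_eq {n : ℕ} (t : ℝ) (ψ : 𝓢(Space n, ℂ)) :
    schrodinger t ψ = 𝓕⁻ (SchwartzMap.smulLeftCLM ℂ (symbol n t) (𝓕 ψ)) := by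
  rw [schrodinger, SchwartzMap.fourierMultiplierCLM_apply]

theorem integral_norm_sq_schrodinger {n : ℕ} (t : ℝ) (ψ : 𝓢(Space n, ℂ)) :
    ∫ x, ‖schrodinger t ψ x‖ ^ 2 = ∫ x, ‖ψ x‖ ^ 2 := by
  rw [← SchwartzMap.integral_norm_sq_fourier (schrodinger t ψ), schrodinger_eq,
    FourierTransform.fourier_fourierInv_eq, ← SchwartzMap.integral_norm_sq_fourier ψ]
  refine integral_congr_ae (Eventually.of_forall fun ξ => ?_)
  simp only [SchwartzMap.smulLeftCLM_apply_apply (hasTemperateGrowth_symbol n t), norm_smul,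
    norm_symbol, one_mul]

theorem schrodinger_apply {n : ℕ} (t : ℝ) (ψ : 𝓢(Space n, ℂ)) (x : Space n) :
    schrodinger t ψ x = ∫ ξ, Complex.exp (-(((t * (2 * Real.pi) ^ 2 : ℝ) : ℂ) * Complex.I)
      * ‖ξ‖ ^ 2 + 2 * Real.pi * Complex.I * inner ℝ x ξ) * 𝓕 ψ ξ := by
  rw [schrodinger_eq, SchwartzMap.fourierInv_coe, Real.fourierInv_eq]
  refine integral_congr_ae (Eventually.of_forall fun ξ => ?_)
  simp only [SchwartzMap.smulLeftCLM_apply_apply (hasTemperateGrowth_symbol n t)]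
  rw [Circle.smul_def, Real.fourierChar_apply, smul_eq_mul, smul_eq_mul, ← mul_assoc, symbol,
    ← Complex.exp_add, real_inner_comm]
  congr 2
  push_cast
  ring

/-- The kernel is a Gaussian with imaginary parameter. Adding `ε > 0` to the parameter makes it
integrable, with an explicit Fourier transform bounded by `‖π/b‖^{n/2}`, and `‖b‖ ≥ π|t|` uniformly
in `ε`. The limit `ε → 0` is taken by dominated convergence. -/
theorem norm_schrodinger_le {n : ℕ} {t : ℝ} (ht : t ≠ 0) (ψ : 𝓢(Space n, ℂ)) (x : Space n) :
    ‖schrodinger t ψ x‖ ≤ |t| ^ (-(n / 2 : ℝ)) * ∫ y, ‖ψ y‖ := by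
  set c : ℝ := t * (2 * Real.pi) ^ 2 with hc
  let G : ℝ → Space n → ℂ := fun ε ξ => Complex.exp (-((ε : ℂ) + (c : ℂ) * Complex.I) * ‖ξ‖ ^ 2
    + 2 * Real.pi * Complex.I * inner ℝ x ξ)
  have hre : ∀ (ε : ℝ) (ξ : Space n), (-((ε : ℂ) + (c : ℂ) * Complex.I) * ‖ξ‖ ^ 2
      + 2 * Real.pi * Complex.I * inner ℝ x ξ).re = -(ε * ‖ξ‖ ^ 2) := fun ε ξ => by
    have : -((ε : ℂ) + (c : ℂ) * Complex.I) * ‖ξ‖ ^ 2 + 2 * Real.pi * Complex.I * inner ℝ x ξ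
        = ((-(ε * ‖ξ‖ ^ 2) : ℝ) : ℂ)
          + ((-(c * ‖ξ‖ ^ 2) + 2 * Real.pi * inner ℝ x ξ : ℝ) : ℂ) * Complex.I := by
      push_cast
      ring
    rw [this, Complex.add_re, Complex.ofReal_re, Complex.re_ofReal_mul, Complex.I_re, mul_zero,
      add_zero]
  have hlim : Tendsto (fun ε : ℝ => ∫ ξ, G ε ξ * 𝓕 ψ ξ) (𝓝[>] 0)
      (𝓝 (schrodinger t ψ x)) := by
    rw [schrodinger_apply]
    refine tendsto_integral_filter_of_dominated_convergence (fun ξ => ‖𝓕 ψ ξ‖) ?_ ?_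
      (𝓕 ψ).integrable.norm ?_
    · refine Eventually.of_forall fun ε => (Continuous.aestronglyMeasurable ?_)
      have := (𝓕 ψ).continuous
      simp only [G]
      fun_prop
    · filter_upwards [self_mem_nhdsWithin] with ε hε
      refine Eventually.of_forall fun ξ => ?_
      rw [norm_mul, Complex.norm_exp, hre]
      have hε0 : 0 < ε := hε
      have : Real.exp (-(ε * ‖ξ‖ ^ 2)) ≤ 1 := Real.exp_le_one_iff.2 (by
        have : 0 ≤ ε * ‖ξ‖ ^ 2 := by positivity
        linarith)
      exact mul_le_of_le_one_left (norm_nonneg _) this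
    · refine Eventually.of_forall fun ξ => ?_
      have hcont : Continuous fun ε : ℝ => G ε ξ * 𝓕 ψ ξ := by
        simp only [G]
        fun_prop
      have := (hcont.tendsto 0).mono_left (nhdsWithin_le_nhds (s := Ioi 0))
      simpa [G, hc] using this
  refine le_of_tendsto hlim.norm ?_
  filter_upwards [self_mem_nhdsWithin] with ε hε
  have hε0 : 0 < ε := hε
  set b : ℂ := (ε : ℂ) + (c : ℂ) * Complex.I with hb
  have hbre : 0 < b.re := by simpa [hb] using hε0
  have hb0 : b ≠ 0 := by intro h; rw [h] at hbre; simp at hbre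
  have hbnorm : Real.pi * |t| ≤ ‖b‖ := by
    have h1 : |b.im| ≤ ‖b‖ := Complex.abs_im_le_norm b
    have h2 : b.im = c := by simp [hb]
    rw [h2, hc, abs_mul, abs_of_nonneg (by positivity : (0 : ℝ) ≤ (2 * Real.pi) ^ 2)] at h1
    refine le_trans ?_ h1
    have h3 := Real.pi_gt_three
    have h4 := abs_nonneg t
    nlinarith [mul_nonneg h4 (by linarith : (0 : ℝ) ≤ Real.pi),
      mul_nonneg h4 (mul_nonneg (by linarith : (0 : ℝ) ≤ Real.pi)
        (by linarith : (0 : ℝ) ≤ Real.pi - 3))]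
  -- The transform is moved from `ψ` to the regularised Gaussian, so that only the `L¹` norm of `ψ`
  -- remains.
  have hflip : ∫ ξ, G ε ξ * 𝓕 ψ ξ = ∫ y, 𝓕 (G ε) y * ψ y := by
    have hG : Integrable (G ε) := GaussianFourier.integrable_cexp_neg_mul_sq_norm_add hbre _ _
    simpa using! (VectorFourier.integral_fourierIntegral_smul_eq_flip (L := innerₗ (Space n))
      Real.continuous_fourierChar continuous_inner hG ψ.integrable).symm
  rw [hflip, ← integral_const_mul]
  refine norm_integral_le_of_norm_le (ψ.integrable.norm.const_mul _)
    (Eventually.of_forall fun y => ?_)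
  rw [norm_mul]
  refine mul_le_mul_of_nonneg_right ?_ (norm_nonneg _)
  simp only [G]
  rw [← hb, fourier_gaussian_innerProductSpace' hbre, norm_mul]
  have h1 : ‖Complex.exp (-(Real.pi : ℂ) ^ 2 * ‖x - y‖ ^ 2 / b)‖ ≤ 1 := by
    rw [Complex.norm_exp, Real.exp_le_one_iff,
      show (-(Real.pi : ℂ) ^ 2 * ‖x - y‖ ^ 2 / b)
        = ((-(Real.pi ^ 2 * ‖x - y‖ ^ 2) : ℝ) : ℂ) * b⁻¹ by push_cast; ring,
      Complex.re_ofReal_mul, Complex.inv_re]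
    exact mul_nonpos_of_nonpos_of_nonneg (neg_nonpos.2 (by positivity))
      (div_nonneg hbre.le (Complex.normSq_nonneg _))
  have h2 : ‖((Real.pi : ℂ) / b) ^ ((Module.finrank ℝ (Space n) : ℂ) / 2)‖
      ≤ |t| ^ (-(n / 2 : ℝ)) := by
    have hexp : ((Module.finrank ℝ (Space n) : ℂ) / 2) = ((n / 2 : ℝ) : ℂ) := by simp
    have hpib : (Real.pi : ℂ) / b ≠ 0 :=
      div_ne_zero (by exact_mod_cast Real.pi_ne_zero) hb0
    rw [hexp, Complex.norm_cpow_of_ne_zero hpib, Complex.ofReal_re, Complex.ofReal_im, mul_zero,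
      Real.exp_zero, div_one, norm_div, Complex.norm_real, Real.norm_eq_abs,
      abs_of_pos Real.pi_pos, Real.rpow_neg (abs_nonneg _), ← Real.inv_rpow (abs_nonneg _)]
    refine Real.rpow_le_rpow (by positivity) ?_ (by positivity)
    rw [div_le_iff₀ (norm_pos_iff.2 hb0), inv_mul_eq_div, le_div_iff₀ (abs_pos.2 ht)]
    exact hbnorm
  calc _ ≤ |t| ^ (-(n / 2 : ℝ)) * 1 := mul_le_mul h2 h1 (norm_nonneg _) (by positivity)
    _ = _ := mul_one _

/-! ### Pairing with weak Lebesgue functions -/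

theorem integrable_of_lintegral_ofReal_le {n : ℕ} {f : Space n → ℝ} {c : ℝ}
    (hm : AEStronglyMeasurable f volume) (hnn : ∀ x, 0 ≤ f x)
    (h : ∫⁻ x, ENNReal.ofReal (f x) ≤ ENNReal.ofReal c) : Integrable f :=
  ⟨hm, (hasFiniteIntegral_iff_ofReal (Eventually.of_forall hnn)).2
    (h.trans_lt ENNReal.ofReal_lt_top)⟩

theorem integral_le_of_lintegral_ofReal_le {n : ℕ} {f : Space n → ℝ} {c : ℝ} (hc : 0 ≤ c)
    (hm : AEStronglyMeasurable f volume) (hnn : ∀ x, 0 ≤ f x)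
    (h : ∫⁻ x, ENNReal.ofReal (f x) ≤ ENNReal.ofReal c) : ∫ x, f x ≤ c := by
  rw [← ofReal_integral_eq_lintegral_ofReal (integrable_of_lintegral_ofReal_le hm hnn h)
    (Eventually.of_forall hnn)] at h
  exact (ENNReal.ofReal_le_ofReal_iff hc).1 h

theorem aestronglyMeasurable_truncation_large {n : ℕ} {f : Space n → ℂ} (M : ℝ)
    (hf : AEStronglyMeasurable f volume) :
    AEStronglyMeasurable (fun x => if M < ‖f x‖ then ‖f x‖ else 0) volume := by
  have h1 : Measurable fun r : ℝ => if M < r then r else 0 :=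
    Measurable.ite measurableSet_Ioi measurable_id measurable_const
  exact (h1.comp_aemeasurable hf.norm.aemeasurable).aestronglyMeasurable

theorem aestronglyMeasurable_truncation_small {n : ℕ} {f : Space n → ℂ} (M : ℝ)
    (hf : AEStronglyMeasurable f volume) :
    AEStronglyMeasurable (fun x => if M < ‖f x‖ then 0 else ‖f x‖ ^ 2) volume := by
  have h1 : Measurable fun r : ℝ => if M < r then 0 else r ^ 2 :=
    Measurable.ite measurableSet_Ioi measurable_const (measurable_id.pow_const 2)
  exact (h1.comp_aemeasurable hf.norm.aemeasurable).aestronglyMeasurable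

theorem DistrBound.integrable_mul {n : ℕ} {q A B : ℝ} {f g : Space n → ℂ} (hq : 1 < q)
    (hA : 0 < A) (hfm : AEStronglyMeasurable f volume) (hf : DistrBound q A f)
    (hg : Integrable g) (hB : ∀ x, ‖g x‖ ≤ B) : Integrable fun x => f x * g x := by
  have h1 := integrable_of_lintegral_ofReal_le (aestronglyMeasurable_truncation_large 1 hfm)
    (fun x => by split_ifs <;> simp)
    (lintegral_truncation_large_le hq hA one_pos hfm hf)
  refine Integrable.mono' ((h1.const_mul B).add hg.norm) (hfm.mul hg.aestronglyMeasurable)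
    (Eventually.of_forall fun x => ?_)
  simp only [Pi.add_apply, norm_mul]
  have h2 := norm_nonneg (g x)
  have h3 := norm_nonneg (f x)
  split_ifs with h
  · nlinarith [hB x]
  · nlinarith [hB x]

theorem exists_norm_le_schwartz {n : ℕ} (ψ : 𝓢(Space n, ℂ)) : ∃ B, ∀ x, ‖ψ x‖ ≤ B := by
  obtain ⟨C, hC⟩ := ψ.decay 0 0
  exact ⟨C, fun x => by simpa using hC.2 x⟩

theorem DistrBound.integrable_mul_schwartz {n : ℕ} {q A : ℝ} {f : Space n → ℂ} (hq : 1 < q)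
    (hA : 0 < A) (hfm : AEStronglyMeasurable f volume) (hf : DistrBound q A f)
    (ψ : 𝓢(Space n, ℂ)) : Integrable fun x => f x * ψ x := by
  obtain ⟨B, hB⟩ := exists_norm_le_schwartz ψ
  exact hf.integrable_mul hq hA hfm ψ.integrable hB

theorem DistrBound.locallyIntegrable {n : ℕ} {q A : ℝ} {f : Space n → ℂ} (hq : 1 < q)
    (hA : 0 < A) (hfm : AEStronglyMeasurable f volume) (hf : DistrBound q A f) :
    LocallyIntegrable f := by
  rw [locallyIntegrable_iff]
  intro K hK
  rw [← integrable_indicator_iff hK.measurableSet]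
  have h1 : Integrable (K.indicator fun _ => (1 : ℂ)) :=
    (integrable_indicator_iff hK.measurableSet).2 (integrableOn_const hK.measure_lt_top.ne)
  refine (hf.integrable_mul (B := 1) hq hA hfm h1 fun x => ?_).congr
    (Eventually.of_forall fun x => ?_)
  · by_cases hx : x ∈ K <;> simp [hx]
  · by_cases hx : x ∈ K <;> simp [hx]

/-- The constant of the restricted weak type interpolation between `L¹ → L^∞` and `L² → L²`. -/
def pairingConst (q : ℝ) : ℝ := q / (q - 1) + 2 / (2 - q) + 1

/-- Real interpolation done by hand: the part of `F` above a height `M` lies in `L¹` and is paired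
with the supremum of `G`; the part below lies in `L²` and is paired with `G` by Young's inequality
with weight `θ`. -/
theorem DistrBound.norm_integral_mul_le {n : ℕ} {q A T e : ℝ} {F G : Space n → ℂ} (hq : 1 < q)
    (hq2 : q < 2) (hA : 0 < A) (hT : 0 < T) (he : 0 < e) (hFm : AEStronglyMeasurable F volume)
    (hF : DistrBound q A F) (hsup : ∀ x, ‖G x‖ ≤ T ^ (1 / 2 : ℝ) * e)
    (hG2 : Integrable fun x => ‖G x‖ ^ 2) (hG2e : ∫ x, ‖G x‖ ^ 2 ≤ e) :
    ‖∫ x, F x * G x‖ ≤ pairingConst q * (A * (e ^ (1 / q) * T ^ (1 / q - 1 / 2))) := by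
  have hq0 : 0 < q := by linarith
  set r : ℝ := T ^ (1 / 2 : ℝ) with hr
  have hr0 : 0 < r := by positivity
  have hrr : r ^ 2 = T := by
    rw [hr, ← Real.rpow_natCast, ← Real.rpow_mul hT.le]; norm_num
  -- With `M = A m` and `θ = e r / (m A)`, the three contributions are all multiples of `A m / r`,
  -- and their coefficients add up to `pairingConst q`.
  set m : ℝ := (e * T) ^ (1 / q) with hm
  have hm0 : 0 < m := by positivity
  have hmq : m ^ q = e * T := by
    rw [hm, ← Real.rpow_mul (by positivity), one_div_mul_cancel hq0.ne', Real.rpow_one]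
  set M : ℝ := A * m with hM
  have hM0 : 0 < M := by positivity
  have hMq : M ^ q = A ^ q * (e * T) := by rw [hM, Real.mul_rpow hA.le hm0.le, hmq]
  set θ : ℝ := e * r / (m * A) with hθ
  have hθ0 : 0 < θ := by positivity
  have hL := lintegral_truncation_large_le hq hA hM0 hFm hF
  have hS := lintegral_truncation_small_le hq2 hA hM0 hFm hF
  have hLm := aestronglyMeasurable_truncation_large M hFm
  have hSm := aestronglyMeasurable_truncation_small M hFm
  have hLnn : ∀ x, 0 ≤ (if M < ‖F x‖ then ‖F x‖ else 0) := fun x => by split_ifs <;> simp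
  have hSnn : ∀ x, 0 ≤ (if M < ‖F x‖ then 0 else ‖F x‖ ^ 2) := fun x => by split_ifs <;> simp
  have hq1 : 0 < q - 1 := by linarith
  have hq2' : 0 < 2 - q := by linarith
  have hLi := integrable_of_lintegral_ofReal_le hLm hLnn hL
  have hSi := integrable_of_lintegral_ofReal_le hSm hSnn hS
  have hLv := integral_le_of_lintegral_ofReal_le (by positivity) hLm hLnn hL
  have hSv := integral_le_of_lintegral_ofReal_le (by positivity) hSm hSnn hS
  have hpt : ∀ x, ‖F x * G x‖ ≤ r * e * (if M < ‖F x‖ then ‖F x‖ else 0)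
      + θ * (if M < ‖F x‖ then 0 else ‖F x‖ ^ 2) + θ⁻¹ * ‖G x‖ ^ 2 := by
    intro x
    rw [norm_mul]
    have h1 := norm_nonneg (F x)
    have h2 := norm_nonneg (G x)
    split_ifs with h
    · have h3 : 0 ≤ θ⁻¹ * ‖G x‖ ^ 2 := by positivity
      nlinarith [mul_le_mul_of_nonneg_left (hsup x) h1]
    · have h3 : θ⁻¹ * ‖G x‖ ^ 2 = θ * (θ⁻¹ * ‖G x‖) ^ 2 := by field_simp
      have h4 : ‖F x‖ * ‖G x‖ = θ * (‖F x‖ * (θ⁻¹ * ‖G x‖)) := by field_simp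
      have h5 : 0 ≤ ‖F x‖ * (θ⁻¹ * ‖G x‖) := by positivity
      rw [h3, h4, mul_zero, zero_add, ← mul_add]
      refine mul_le_mul_of_nonneg_left ?_ hθ0.le
      nlinarith [sq_nonneg (‖F x‖ - θ⁻¹ * ‖G x‖)]
  have hI1 := hLi.const_mul (r * e)
  have hI2 := hSi.const_mul θ
  have hI3 := hG2.const_mul θ⁻¹
  have hbound := norm_integral_le_of_norm_le ((hI1.add hI2).add hI3) (Eventually.of_forall hpt)
  refine hbound.trans ?_
  have hsum : ∫ x, ((((fun x => r * e * (if M < ‖F x‖ then ‖F x‖ else 0))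
      + fun x => θ * (if M < ‖F x‖ then 0 else ‖F x‖ ^ 2)) + fun x => θ⁻¹ * ‖G x‖ ^ 2) x)
      = r * e * (∫ x, (if M < ‖F x‖ then ‖F x‖ else 0))
        + θ * (∫ x, (if M < ‖F x‖ then 0 else ‖F x‖ ^ 2)) + θ⁻¹ * ∫ x, ‖G x‖ ^ 2 := by
    rw [integral_add' (hI1.add hI2) hI3, integral_add' hI1 hI2, integral_const_mul,
      integral_const_mul, integral_const_mul]
  rw [hsum]
  have hML : A ^ q * M ^ (1 - q) = A * m / (e * T) := by
    rw [Real.rpow_sub hM0, Real.rpow_one, hMq]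
    field_simp
    exact hM
  have hMS : A ^ q * M ^ (2 - q) = (A * m) ^ 2 / (e * T) := by
    rw [Real.rpow_sub hM0, hMq, Real.rpow_two]
    field_simp
    rw [hM, mul_pow]
  have hfin : e ^ (1 / q) * T ^ (1 / q - 1 / 2) = m / r := by
    rw [Real.rpow_sub hT, hm, Real.mul_rpow he.le hT.le, mul_div_assoc]
  rw [hML] at hLv
  rw [hMS] at hSv
  rw [hfin]
  calc _ ≤ r * e * (q / (q - 1) * (A * m / (e * T)))
        + θ * (2 / (2 - q) * ((A * m) ^ 2 / (e * T))) + θ⁻¹ * e := by gcongr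
    _ = pairingConst q * (A * (m / r)) := by
        rw [pairingConst, hθ, ← hrr]
        field_simp

/-- The decay exponent `nρ / (2(ρ+2))` of `S(t) : L^{((ρ+2)/(ρ+1),∞)} → L^{(ρ+2,∞)}`. -/
def decayExp (n : ℕ) (ρ : ℝ) : ℝ := n * ρ / (2 * (ρ + 2))

/-- Interpolation with `T = |τ|^{-n}`: the dispersive estimate supplies the supremum bound and
unitarity the `L²` bound. The single parameter `e` bounds both norms of `ψ`, as the measure of a set
does for its indicator. -/
theorem DistrBound.norm_integral_mul_schrodinger_le {n : ℕ} {ρ A τ e : ℝ} {F : Space n → ℂ}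
    (hρ : 0 < ρ) (hA : 0 < A) (hτ : τ ≠ 0) (he : 0 < e) (hFm : AEStronglyMeasurable F volume)
    (hF : DistrBound ((ρ + 2) / (ρ + 1)) A F) (ψ : 𝓢(Space n, ℂ)) (h1 : ∫ x, ‖ψ x‖ ≤ e)
    (h2 : ∫ x, ‖ψ x‖ ^ 2 ≤ e) :
    ‖∫ x, F x * schrodinger τ ψ x‖ ≤ pairingConst ((ρ + 2) / (ρ + 1)) *
      (A * (e ^ ((ρ + 1) / (ρ + 2)) * |τ| ^ (-decayExp n ρ))) := by
  have hτ0 := abs_pos.2 hτ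
  have hq : 1 < (ρ + 2) / (ρ + 1) := by rw [lt_div_iff₀ (by linarith)]; linarith
  have hq2 : (ρ + 2) / (ρ + 1) < 2 := by rw [div_lt_iff₀ (by linarith)]; linarith
  have hsup : ∀ x, ‖schrodinger τ ψ x‖ ≤ (|τ| ^ (-(n : ℝ))) ^ (1 / 2 : ℝ) * e := fun x => by
    refine (norm_schrodinger_le hτ ψ x).trans ?_
    rw [← Real.rpow_mul hτ0.le, show -(n : ℝ) * (1 / 2) = -(n / 2) by ring]
    gcongr
  have hint : Integrable fun x => ‖schrodinger τ ψ x‖ ^ 2 := by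
    simpa using ((schrodinger τ ψ).memLp 2).integrable_norm_pow (by norm_num)
  have := hF.norm_integral_mul_le hq hq2 hA (by positivity : 0 < |τ| ^ (-(n : ℝ))) he hFm hsup
    hint (by rwa [integral_norm_sq_schrodinger])
  convert this using 4
  · rw [one_div_div]
  · rw [← Real.rpow_mul hτ0.le, decayExp]
    congr 1
    field_simp
    ring

/-! ### The nonlinearity -/

/-- By homogeneity this is `1 - x^ρ ≤ (ρ+1)(1-x)` on `[0,1]`: Bernoulli's inequality if `ρ ≥ 1`, and
`x ≤ x^ρ` if `ρ ≤ 1`. The extra factor `a` avoids the singular derivative of `x^ρ` at zero when `ρ <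
1`. -/
theorem rpow_sub_rpow_mul_le {ρ a b : ℝ} (hρ : 0 < ρ) (hb : 0 ≤ b) (hab : b ≤ a) :
    (a ^ ρ - b ^ ρ) * a ≤ (ρ + 1) * (a ^ ρ * (a - b)) := by
  rcases eq_or_lt_of_le (hb.trans hab) with h0 | ha
  · rw [← h0]; simp only [mul_zero, zero_sub]
    rw [Real.zero_rpow hρ.ne']; simp
  have hx1 : b / a ≤ 1 := (div_le_one ha).2 hab
  have hx0 : 0 ≤ b / a := by positivity
  have key : 1 - (b / a) ^ ρ ≤ (ρ + 1) * (1 - b / a) := by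
    rcases le_total 1 ρ with h | h
    · have := one_add_mul_self_le_rpow_one_add (s := b / a - 1) (by linarith) h
      rw [add_sub_cancel] at this
      nlinarith
    · have := Real.rpow_le_rpow_of_exponent_ge' hx0 hx1 hρ.le h
      rw [Real.rpow_one] at this
      nlinarith
  have hb' : b ^ ρ = (b / a) ^ ρ * a ^ ρ := by
    rw [Real.div_rpow hb ha.le]; field_simp
  have hab' : a - b = a * (1 - b / a) := by field_simp
  have hpos : 0 ≤ a ^ ρ * a := by positivity
  rw [hb', hab']
  nlinarith [mul_le_mul_of_nonneg_left key hpos]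

theorem norm_nonlinearity_sub_le {ρ : ℝ} (hρ : 0 < ρ) (a b : ℂ) :
    ‖((‖a‖ ^ ρ : ℝ) : ℂ) * a - ((‖b‖ ^ ρ : ℝ) : ℂ) * b‖
      ≤ (‖a‖ + ‖b‖) ^ ρ * ((ρ + 2) * ‖a - b‖) := by
  wlog h : ‖b‖ ≤ ‖a‖ generalizing a b
  · rw [norm_sub_rev, add_comm ‖a‖, norm_sub_rev a]
    exact this b a (le_of_not_ge h)
  have ha := norm_nonneg a
  have hb := norm_nonneg b
  have e1 : ((‖a‖ ^ ρ : ℝ) : ℂ) * a - ((‖b‖ ^ ρ : ℝ) : ℂ) * b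
      = ((‖a‖ ^ ρ - ‖b‖ ^ ρ : ℝ) : ℂ) * a + ((‖b‖ ^ ρ : ℝ) : ℂ) * (a - b) := by
    push_cast; ring
  have h1 : ‖b‖ ^ ρ ≤ ‖a‖ ^ ρ := Real.rpow_le_rpow hb h hρ.le
  have h2 : ‖a‖ ^ ρ ≤ (‖a‖ + ‖b‖) ^ ρ := Real.rpow_le_rpow ha (by linarith) hρ.le
  have h3 : ‖a‖ - ‖b‖ ≤ ‖a - b‖ := norm_sub_norm_le a b
  have h4 : 0 ≤ ‖a‖ ^ ρ := by positivity
  rw [e1]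
  refine (norm_add_le _ _).trans ?_
  rw [norm_mul, norm_mul, Complex.norm_real, Complex.norm_real, Real.norm_eq_abs,
    Real.norm_eq_abs, abs_of_nonneg (by linarith), abs_of_nonneg (by positivity)]
  calc (‖a‖ ^ ρ - ‖b‖ ^ ρ) * ‖a‖ + ‖b‖ ^ ρ * ‖a - b‖
      ≤ (ρ + 1) * (‖a‖ ^ ρ * ‖a - b‖) + ‖a‖ ^ ρ * ‖a - b‖ := by
        refine add_le_add ((rpow_sub_rpow_mul_le hρ hb h).trans ?_) (by gcongr)
        gcongr
    _ = ‖a‖ ^ ρ * ((ρ + 2) * ‖a - b‖) := by ring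
    _ ≤ _ := by gcongr

theorem DistrBound.nonlinearity {n : ℕ} {ρ A : ℝ} {u : Space n → ℂ} (hρ : 0 < ρ) (hA : 0 < A)
    (hu : DistrBound (ρ + 2) A u) :
    DistrBound ((ρ + 2) / (ρ + 1)) (2 * (A ^ ρ * A))
      (fun x => ((‖u x‖ ^ ρ : ℝ) : ℂ) * u x) :=
  hu.mul_rpow hρ hA hA hu fun x => by
    rw [norm_mul, Complex.norm_real, Real.norm_eq_abs, abs_of_nonneg (by positivity)]

/-- The constant of the local Lipschitz bound of `u ↦ |u|^ρ u` in weak Lebesgue spaces. -/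
def lipConst (ρ : ℝ) : ℝ := 2 * 4 ^ ρ * (ρ + 2)

/-- Weak Hölder applied to `|u| + |v|` and `(ρ+2)(u - v)`. The quasi-triangle inequality bounds the
first by `4A`, whence the `4^ρ` in `lipConst`. -/
theorem DistrBound.nonlinearity_sub {n : ℕ} {ρ A D : ℝ} {u v : Space n → ℂ} (hρ : 0 < ρ)
    (hA : 0 < A) (hD : 0 < D) (hu : DistrBound (ρ + 2) A u) (hv : DistrBound (ρ + 2) A v)
    (huv : DistrBound (ρ + 2) D fun x => u x - v x) :
    DistrBound ((ρ + 2) / (ρ + 1)) (lipConst ρ * (A ^ ρ * D))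
      (fun x => ((‖u x‖ ^ ρ : ℝ) : ℂ) * u x - ((‖v x‖ ^ ρ : ℝ) : ℂ) * v x) := by
  have hu' : DistrBound (ρ + 2) A fun x => ((‖u x‖ : ℝ) : ℂ) := by
    simpa only [DistrBound, Complex.norm_real, norm_norm] using hu
  have hv' : DistrBound (ρ + 2) A fun x => ((‖v x‖ : ℝ) : ℂ) := by
    simpa only [DistrBound, Complex.norm_real, norm_norm] using hv
  have h2 : DistrBound (ρ + 2) ((ρ + 2) * D) fun x => ((ρ + 2 : ℝ) : ℂ) * (u x - v x) := by
    intro s hs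
    have := huv (s / (ρ + 2)) (by positivity)
    simp only [norm_mul, Complex.norm_real, Real.norm_eq_abs,
      abs_of_pos (by linarith : 0 < ρ + 2)]
    simp only [div_lt_iff₀' (by linarith : 0 < ρ + 2)] at this
    rwa [div_div_eq_mul_div, mul_comm D] at this
  have h3 := (hu'.add (by linarith) hA.le hA.le hv').mul_rpow (F := fun x =>
    ((‖u x‖ ^ ρ : ℝ) : ℂ) * u x - ((‖v x‖ ^ ρ : ℝ) : ℂ) * v x) hρ (by positivity)
    (by positivity) h2 fun x => by
      rw [← Complex.ofReal_add, Complex.norm_real, norm_mul, Complex.norm_real, Real.norm_eq_abs,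
        Real.norm_eq_abs, abs_of_nonneg (by positivity), abs_of_nonneg (by positivity)]
      exact norm_nonlinearity_sub_le hρ _ _
  convert h3 using 1
  rw [lipConst, show 2 * (A + A) = 4 * A by ring, Real.mul_rpow (by norm_num) hA.le]
  ring

/-! ### Duality -/

/-- A shrinking sequence of bump functions at the origin. -/
def mollifier (n k : ℕ) : ContDiffBump (0 : Space n) where
  rIn := 1 / (k + 1)
  rOut := 2 / (k + 1)
  rIn_pos := by positivity
  rIn_lt_rOut := by gcongr; norm_num

/-- Mollification. The common bound and common compact support allow dominated convergence; the
convergence itself is Lebesgue differentiation. -/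
theorem exists_schwartz_approx {n : ℕ} {f : Space n → ℂ} {R : ℝ}
    (hfm : AEStronglyMeasurable f volume) (hf1 : ∀ x, ‖f x‖ ≤ 1) (hfR : ∀ x, R < ‖x‖ → f x = 0) :
    ∃ ψ : ℕ → 𝓢(Space n, ℂ), (∀ k x, ‖ψ k x‖ ≤ 1) ∧ (∀ k x, R + 2 < ‖x‖ → ψ k x = 0) ∧
      ∀ᵐ x, Tendsto (fun k => ψ k x) atTop (𝓝 (f x)) := by
  have hsupp : Function.support f ⊆ Metric.closedBall 0 R := fun x hx => by
    rw [mem_closedBall_zero_iff]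
    by_contra hcon
    exact hx (hfR x (not_le.1 hcon))
  have hfi : Integrable f := by
    have h1 : Integrable ((Metric.closedBall (0 : Space n) R).indicator fun _ => (1 : ℝ)) :=
      (integrable_indicator_iff Metric.isClosed_closedBall.measurableSet).2
        (integrableOn_const (isCompact_closedBall _ _).measure_lt_top.ne)
    refine h1.mono' hfm (Eventually.of_forall fun x => ?_)
    by_cases hx : x ∈ Metric.closedBall (0 : Space n) R
    · simpa [hx] using hf1 x
    · have : f x = 0 := by
        by_contra hcon
        exact hx (hsupp hcon)
      simp [hx, this]
  let c : ℕ → Space n → ℂ := fun k =>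
    convolution ((mollifier n k).normed volume) f (ContinuousLinearMap.lsmul ℝ ℝ) volume
  have hcR : ∀ k x, R + 2 < ‖x‖ → c k x = 0 := fun k x hx => by
    by_contra hcon
    have h1 := support_convolution_subset (L := ContinuousLinearMap.lsmul ℝ ℝ) (μ := volume) hcon
    obtain ⟨y, hy, z, hz, rfl⟩ := h1
    have hy' : ‖y‖ < 2 / ((k : ℝ) + 1) := by
      rw [ContDiffBump.support_normed_eq] at hy
      simpa [mollifier] using hy
    have hz' : ‖z‖ ≤ R := by simpa using hsupp hz
    have h2 : 2 / ((k : ℝ) + 1) ≤ 2 := div_le_self (by norm_num) (by linarith [k.cast_nonneg (α := ℝ)])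
    have := norm_add_le y z
    simp only at hx
    linarith
  have hc1 : ∀ k x, ‖c k x‖ ≤ 1 := fun k x => by
    have hn := (mollifier n k).integrable_normed (μ := volume)
    refine (norm_integral_le_of_norm_le hn (Eventually.of_forall fun y => ?_)).trans_eq
      (mollifier n k).integral_normed
    rw [ContinuousLinearMap.lsmul_apply, norm_smul, Real.norm_eq_abs,
      abs_of_nonneg ((mollifier n k).nonneg_normed y)]
    exact mul_le_of_le_one_right ((mollifier n k).nonneg_normed y) (hf1 _)
  have hcc : ∀ k, HasCompactSupport (c k) := fun k => by
    refine HasCompactSupport.of_support_subset_isCompact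
      (isCompact_closedBall (0 : Space n) (R + 2)) fun x hx => ?_
    rw [mem_closedBall_zero_iff]
    by_contra hcon
    exact hx (hcR k x (not_le.1 hcon))
  have hcs : ∀ k, ContDiff ℝ (⊤ : ℕ∞) (c k) := fun k =>
    (mollifier n k).hasCompactSupport_normed.contDiff_convolution_left _
      (mollifier n k).contDiff_normed hfi.locallyIntegrable
  refine ⟨fun k => (hcc k).toSchwartzMap (hcs k), hc1, hcR, ?_⟩
  -- The outer radius stays at twice the inner one, so the bumps are comparable with averages over
  -- balls.
  refine ContDiffBump.ae_convolution_tendsto_right_of_locallyIntegrable (K := 2) ?_ ?_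
    hfi.locallyIntegrable
  · have := (tendsto_one_div_add_atTop_nhds_zero_nat (𝕜 := ℝ)).const_mul 2
    simpa [mollifier, div_eq_mul_inv] using this
  · exact Eventually.of_forall fun k => by simp [mollifier, div_eq_mul_inv]

/-- Here `m` is the measure of a level set at height `s`; dividing by `m^{1-1/p}` turns the duality
bound into a distribution bound. -/
theorem le_rpow_of_mul_le_rpow {p K s m : ℝ} (hp : 1 < p) (hK : 0 < K) (hs : 0 < s) (hm : 0 < m)
    (h : s * m ≤ K * (2 * m) ^ (1 - 1 / p)) : m ≤ (2 * K / s) ^ p := by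
  have hp0 : 0 < p := by linarith
  have h2 : (2 : ℝ) ^ (1 - 1 / p) ≤ 2 := by
    have : 1 - 1 / p ≤ 1 := by
      have : 0 < 1 / p := by positivity
      linarith
    simpa using Real.rpow_le_rpow_of_exponent_le (x := 2) (by norm_num) this
  have h3 : m ^ (1 / p) ≤ 2 * K / s := by
    rw [Real.mul_rpow (by norm_num) hm.le, Real.rpow_sub hm, Real.rpow_one] at h
    rw [le_div_iff₀ hs]
    have hmp : 0 < m ^ (1 / p) := by positivity
    have h4 : s * m * m ^ (1 / p) ≤ K * 2 ^ (1 - 1 / p) * m := by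
      have := mul_le_mul_of_nonneg_right h hmp.le
      refine this.trans_eq ?_
      field_simp
    have h5 : K * 2 ^ (1 - 1 / p) * m ≤ K * 2 * m := by gcongr
    nlinarith
  calc m = (m ^ (1 / p)) ^ p := by
        rw [← Real.rpow_mul hm.le, one_div_mul_cancel hp0.ne', Real.rpow_one]
    _ ≤ _ := Real.rpow_le_rpow (by positivity) h3 hp0.le

/-- The weak Lebesgue bound of a function is determined by its pairings with Schwartz functions. -/
theorem distrBound_of_pairing {n : ℕ} {p K : ℝ} {g : Space n → ℂ} (hp : 1 < p) (hK : 0 < K)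
    (hgm : AEStronglyMeasurable g volume) (hg : LocallyIntegrable g)
    (h : ∀ (e : ℝ) (ψ : 𝓢(Space n, ℂ)), 0 < e → ∫ x, ‖ψ x‖ ≤ e → ∫ x, ‖ψ x‖ ^ 2 ≤ e →
      ‖∫ x, g x * ψ x‖ ≤ K * e ^ (1 - 1 / p)) :
    DistrBound p (2 * K) g := by
  intro s hs
  obtain ⟨g', hg'm, hgg'⟩ := hgm
  have hmeas : volume {x | s < ‖g x‖} = volume {x | s < ‖g' x‖} := by
    refine measure_congr ?_
    filter_upwards [hgg'] with x hx
    change (s < ‖g x‖) = (s < ‖g' x‖)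
    rw [hx]
  rw [hmeas]
  set S : Set (Space n) := {x | s < ‖g' x‖} with hS
  have hSm : MeasurableSet S := measurableSet_lt measurable_const hg'm.norm.measurable
  -- The level set might have infinite measure, so it is exhausted by bounded pieces.
  have hcover : S = ⋃ R : ℕ, S ∩ Metric.closedBall 0 R := by
    rw [← inter_iUnion]
    have : (⋃ R : ℕ, Metric.closedBall (0 : Space n) R) = univ := by
      refine eq_univ_of_forall fun x => ?_
      obtain ⟨R, hR⟩ := exists_nat_ge ‖x‖
      exact mem_iUnion.2 ⟨R, by simpa using hR⟩
    rw [this, inter_univ]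
  have hmono : Monotone fun R : ℕ => S ∩ Metric.closedBall (0 : Space n) R := fun a b hab =>
    inter_subset_inter_right _ (Metric.closedBall_subset_closedBall (by exact_mod_cast hab))
  rw [hcover, hmono.measure_iUnion]
  refine iSup_le fun R => ?_
  set E : Set (Space n) := S ∩ Metric.closedBall (0 : Space n) R with hE
  have hEm : MeasurableSet E := hSm.inter Metric.isClosed_closedBall.measurableSet
  have hEfin : volume E ≠ ∞ :=
    ((measure_mono inter_subset_right).trans_lt (isCompact_closedBall _ _).measure_lt_top).ne
  set m : ℝ := volume.real E with hm
  have hEm' : volume E = ENNReal.ofReal m := (ENNReal.ofReal_toReal hEfin).symm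
  rw [hEm']
  have hmnn : 0 ≤ m := measureReal_nonneg
  rcases hmnn.eq_or_lt with h0 | hm0
  · rw [← h0]; simp
  refine ENNReal.ofReal_le_ofReal (le_rpow_of_mul_le_rpow hp hK hs hm0 ?_)
  -- The conjugate phase of `g'` on `E`: pairing with it gives `∫_E ‖g'‖ ≥ s m`, while `∫ ‖f‖ = ∫
  -- ‖f‖² = m`.
  let f : Space n → ℂ := E.indicator fun x => (starRingEnd ℂ) (g' x) * ((‖g' x‖⁻¹ : ℝ) : ℂ)
  have hg'ne : ∀ x ∈ E, ‖g' x‖ ≠ 0 := fun x hx => (hs.trans hx.1).ne'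
  have hfE : ∀ x ∈ E, ‖f x‖ = 1 := fun x hx => by
    have := hg'ne x hx
    simp [f, hx, this]
  have hfE' : ∀ x ∉ E, f x = 0 := fun x hx => by simp [f, hx]
  have hfnorm : ∀ x, ‖f x‖ = E.indicator (fun _ => (1 : ℝ)) x := fun x => by
    by_cases hx : x ∈ E
    · rw [hfE x hx, indicator_of_mem hx]
    · rw [hfE' x hx, indicator_of_notMem hx, norm_zero]
  have hfm : AEStronglyMeasurable f volume := by
    refine StronglyMeasurable.aestronglyMeasurable (StronglyMeasurable.indicator ?_ hEm)
    have h1 : Measurable g' := hg'm.measurable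
    exact (((Complex.continuous_conj.measurable.comp h1).mul
      (Complex.measurable_ofReal.comp h1.norm.inv))).stronglyMeasurable
  have hf1 : ∀ x, ‖f x‖ ≤ 1 := fun x => by
    rw [hfnorm]
    by_cases hx : x ∈ E <;> simp [hx]
  have hfR : ∀ x, (R : ℝ) < ‖x‖ → f x = 0 := fun x hx => hfE' x fun hxE => by
    have := hxE.2
    rw [mem_closedBall_zero_iff] at this
    linarith
  obtain ⟨ψ, hψ1, hψR, hψlim⟩ := exists_schwartz_approx hfm hf1 hfR
  set B := Metric.closedBall (0 : Space n) (R + 2) with hB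
  have hBm : MeasurableSet B := Metric.isClosed_closedBall.measurableSet
  have hBi : Integrable (B.indicator fun _ => (1 : ℝ)) :=
    (integrable_indicator_iff hBm).2
      (integrableOn_const (isCompact_closedBall _ _).measure_lt_top.ne)
  have hψB : ∀ k x, x ∉ B → ψ k x = 0 := fun k x hx => hψR k x (by
    rw [hB, mem_closedBall_zero_iff, not_le] at hx
    exact hx)
  have hl1 : Tendsto (fun k => ∫ x, ‖ψ k x‖) atTop (𝓝 m) := by
    have : m = ∫ x, ‖f x‖ := by simp_rw [hfnorm]; rw [integral_indicator_const _ hEm]; simp [hm]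
    rw [this]
    refine tendsto_integral_of_dominated_convergence (B.indicator fun _ => (1 : ℝ))
      (fun k => (ψ k).continuous.norm.aestronglyMeasurable) hBi
      (fun k => Eventually.of_forall fun x => ?_) (hψlim.mono fun x hx => hx.norm)
    by_cases hx : x ∈ B
    · simpa [hx] using hψ1 k x
    · simp [hx, hψB k x hx]
  have hl2 : Tendsto (fun k => ∫ x, ‖ψ k x‖ ^ 2) atTop (𝓝 m) := by
    have : m = ∫ x, ‖f x‖ ^ 2 := by
      have h1 : ∀ x, ‖f x‖ ^ 2 = E.indicator (fun _ => (1 : ℝ)) x := fun x => by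
        rw [hfnorm]
        by_cases hx : x ∈ E <;> simp [hx]
      simp_rw [h1]; rw [integral_indicator_const _ hEm]; simp [hm]
    rw [this]
    refine tendsto_integral_of_dominated_convergence (B.indicator fun _ => (1 : ℝ))
      (fun k => ((ψ k).continuous.norm.pow 2).aestronglyMeasurable) hBi
      (fun k => Eventually.of_forall fun x => ?_) (hψlim.mono fun x hx => hx.norm.pow 2)
    by_cases hx : x ∈ B
    · simpa [hx] using hψ1 k x
    · simp [hx, hψB k x hx]
  have hgB : Integrable (B.indicator fun x => ‖g x‖) :=
    (integrable_indicator_iff hBm).2 (hg.integrableOn_isCompact (isCompact_closedBall _ _)).norm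
  have hl3 : Tendsto (fun k => ∫ x, g x * ψ k x) atTop (𝓝 (∫ x, g x * f x)) := by
    refine tendsto_integral_of_dominated_convergence (B.indicator fun x => ‖g x‖)
      (fun k => hg.aestronglyMeasurable.mul (ψ k).continuous.aestronglyMeasurable) hgB
      (fun k => Eventually.of_forall fun x => ?_) (hψlim.mono fun x hx => hx.const_mul _)
    by_cases hx : x ∈ B
    · simpa [hx] using mul_le_of_le_one_right (norm_nonneg _) (hψ1 k x)
    · simp [hx, hψB k x hx]
  -- The norms of the approximants tend to `m` but may exceed it, so the hypothesis is applied with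
  -- `e = 2m`.
  have hle : ‖∫ x, g x * f x‖ ≤ K * (2 * m) ^ (1 - 1 / p) := by
    refine le_of_tendsto hl3.norm ?_
    filter_upwards [hl1.eventually_le_const (by linarith : m < 2 * m),
      hl2.eventually_le_const (by linarith : m < 2 * m)] with k h1 h2
    exact h _ _ (by linarith) h1 h2
  refine le_trans ?_ hle
  have hgf : ∫ x, g x * f x = ((∫ x in E, ‖g' x‖ : ℝ) : ℂ) := by
    rw [← integral_indicator hEm, ← integral_complex_ofReal]
    refine integral_congr_ae ?_
    filter_upwards [hgg'] with x hx
    rw [hx]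
    by_cases hxE : x ∈ E
    · have h1 := hg'ne x hxE
      have h2 : (‖g' x‖ : ℂ) ≠ 0 := by exact_mod_cast h1
      simp only [f, indicator_of_mem hxE, Complex.ofReal_inv]
      rw [← mul_assoc, Complex.mul_conj', sq]
      field_simp
    · simp [f, hxE]
  rw [hgf, Complex.norm_real, Real.norm_eq_abs, abs_of_nonneg (integral_nonneg fun _ => norm_nonneg _)]
  have hg'i : IntegrableOn (fun x => ‖g' x‖) E := by
    have h1 : LocallyIntegrable g' := by
      rw [locallyIntegrable_iff] at hg ⊢
      exact fun k hk => (hg k hk).congr (ae_restrict_of_ae hgg')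
    exact ((h1.integrableOn_isCompact (isCompact_closedBall _ _)).mono_set inter_subset_right).norm
  calc s * m = ∫ _ in E, s := by rw [setIntegral_const, smul_eq_mul, mul_comm]
    _ ≤ ∫ x in E, ‖g' x‖ := setIntegral_mono_on (integrableOn_const hEfin) hg'i hEm
        fun x hx => hx.1.le

/-! ### The Duhamel estimate -/

/-- The Beta integral `∫₀¹ (1-τ)^{-a} τ^{-b} dτ`. -/
def betaInt (a b : ℝ) : ℝ := ∫ τ in (0 : ℝ)..1, (1 - τ) ^ (-a) * τ ^ (-b)

theorem intervalIntegrable_betaInt {a b : ℝ} (ha : a < 1) (hb : b < 1) :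
    IntervalIntegrable (fun τ : ℝ => (1 - τ) ^ (-a) * τ ^ (-b)) volume 0 1 := by
  have h := (Complex.betaIntegral_convergent (u := ((1 - b : ℝ) : ℂ)) (v := ((1 - a : ℝ) : ℂ))
    (by rw [Complex.ofReal_re]; linarith) (by rw [Complex.ofReal_re]; linarith)).norm
  rw [intervalIntegrable_iff_integrableOn_Ioo_of_le zero_le_one] at h ⊢
  refine h.congr_fun (fun τ hτ => ?_) measurableSet_Ioo
  have h1 : (1 : ℂ) - τ = ((1 - τ : ℝ) : ℂ) := by push_cast; rfl
  have hτ1 : 0 < 1 - τ := by linarith [hτ.2]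
  simp only
  rw [norm_mul, h1, Complex.norm_cpow_eq_rpow_re_of_pos hτ.1,
    Complex.norm_cpow_eq_rpow_re_of_pos hτ1, mul_comm]
  simp

theorem betaInt_nonneg (a b : ℝ) : 0 ≤ betaInt a b :=
  intervalIntegral.integral_nonneg zero_le_one fun τ hτ => by
    have h1 := hτ.1
    have h2 : 0 ≤ 1 - τ := by linarith [hτ.2]
    positivity

theorem mem_times_of_abs_le {T : ℝ≥0∞} {s t : ℝ} (ht : t ∈ times T) (hs : s ≠ 0)
    (hst : |s| ≤ |t|) : s ∈ times T :=
  ⟨hs, (ENNReal.ofReal_le_ofReal hst).trans_lt ht.2⟩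

theorem aestronglyMeasurable_nonlinearity {n : ℕ} {ρ : ℝ} (hρ : 0 < ρ) {u : Space n → ℂ}
    (hu : AEStronglyMeasurable u volume) :
    AEStronglyMeasurable (fun x => ((‖u x‖ ^ ρ : ℝ) : ℂ) * u x) volume :=
  (Complex.continuous_ofReal.comp_aestronglyMeasurable
    ((Real.continuous_rpow_const hρ.le).comp_aestronglyMeasurable hu.norm)).mul hu

theorem norm_duhamelPairing_sub_le {n : ℕ} {ρ A D e t s : ℝ} {u v : ℝ → Space n → ℂ}
    (hρ : 0 < ρ) (hA : 0 < A) (hD : 0 < D) (he : 0 < e) (hts : t - s ≠ 0)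
    (hum : AEStronglyMeasurable (u s) volume) (hvm : AEStronglyMeasurable (v s) volume)
    (hu : DistrBound (ρ + 2) A (u s)) (hv : DistrBound (ρ + 2) A (v s))
    (huv : DistrBound (ρ + 2) D fun x => u s x - v s x) (ψ : 𝓢(Space n, ℂ))
    (h1 : ∫ x, ‖ψ x‖ ≤ e) (h2 : ∫ x, ‖ψ x‖ ^ 2 ≤ e) :
    ‖duhamelPairing ρ u t s ψ - duhamelPairing ρ v t s ψ‖
      ≤ pairingConst ((ρ + 2) / (ρ + 1)) * (lipConst ρ * (A ^ ρ * D) *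
        (e ^ ((ρ + 1) / (ρ + 2)) * |t - s| ^ (-decayExp n ρ))) := by
  have hq : 1 < (ρ + 2) / (ρ + 1) := by rw [lt_div_iff₀ (by linarith)]; linarith
  have hlip : 0 < lipConst ρ := by unfold lipConst; positivity
  have hNu := aestronglyMeasurable_nonlinearity hρ hum
  have hNv := aestronglyMeasurable_nonlinearity hρ hvm
  have hiu := (hu.nonlinearity hρ hA).integrable_mul_schwartz hq (by positivity) hNu
    (schrodinger (t - s) ψ)
  have hiv := (hv.nonlinearity hρ hA).integrable_mul_schwartz hq (by positivity) hNv
    (schrodinger (t - s) ψ)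
  rw [duhamelPairing, duhamelPairing, ← integral_sub hiu hiv]
  simp only [← sub_mul]
  exact (hu.nonlinearity_sub hρ hA hD hv huv).norm_integral_mul_schrodinger_le hρ
    (by positivity) hts he (hNu.sub hNv) ψ h1 h2

/-- The constant of the Duhamel estimate. -/
def duhamelConst (ρ : ℝ) (lam : ℂ) : ℝ :=
  2 * ((‖lam‖ + 1) * (pairingConst ((ρ + 2) / (ρ + 1)) * lipConst ρ))

/-- The `‖lam‖ + 1` in the constant keeps it positive when `lam = 0`. -/
theorem duhamelConst_pos {ρ : ℝ} (hρ : 0 < ρ) (lam : ℂ) : 0 < duhamelConst ρ lam := by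
  have hq : 0 < (ρ + 2) / (ρ + 1) - 1 := by
    rw [sub_pos, lt_div_iff₀ (by linarith)]; linarith
  have hq2 : 0 < 2 - (ρ + 2) / (ρ + 1) := by
    rw [sub_pos, div_lt_iff₀ (by linarith)]; linarith
  unfold duhamelConst pairingConst lipConst
  positivity

/-- Substituting `s = tτ` separates the powers of `|t|` from the Beta integrals. Two power laws are
allowed for `u - v` so that near and far times can be weighted differently in the stability
argument. -/
theorem norm_integral_duhamelPairing_sub_le {n : ℕ} {ρ A κ K₁ μ₁ K₂ μ₂ e t : ℝ}
    {u v : ℝ → Space n → ℂ} (hρ : 0 < ρ) (hA : 0 < A) (hK₁ : 0 < K₁) (hK₂ : 0 ≤ K₂) (he : 0 < e)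
    (hσ : decayExp n ρ < 1) (hμ₁ : κ * ρ + μ₁ < 1) (hμ₂ : κ * ρ + μ₂ < 1) (ht : t ≠ 0)
    (hum : ∀ s, s ≠ 0 → |s| ≤ |t| → AEStronglyMeasurable (u s) volume)
    (hvm : ∀ s, s ≠ 0 → |s| ≤ |t| → AEStronglyMeasurable (v s) volume)
    (hu : ∀ s, s ≠ 0 → |s| ≤ |t| → DistrBound (ρ + 2) (A * |s| ^ (-κ)) (u s))
    (hv : ∀ s, s ≠ 0 → |s| ≤ |t| → DistrBound (ρ + 2) (A * |s| ^ (-κ)) (v s))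
    (huv : ∀ s, s ≠ 0 → |s| ≤ |t| →
      DistrBound (ρ + 2) (K₁ * |s| ^ (-μ₁) + K₂ * |s| ^ (-μ₂)) fun x => u s x - v s x)
    (ψ : 𝓢(Space n, ℂ)) (h1 : ∫ x, ‖ψ x‖ ≤ e) (h2 : ∫ x, ‖ψ x‖ ^ 2 ≤ e) :
    ‖∫ s in (0 : ℝ)..t, (duhamelPairing ρ u t s ψ - duhamelPairing ρ v t s ψ)‖
      ≤ pairingConst ((ρ + 2) / (ρ + 1)) * lipConst ρ * A ^ ρ *
        (K₁ * betaInt (decayExp n ρ) (κ * ρ + μ₁) * |t| ^ (1 - decayExp n ρ - (κ * ρ + μ₁))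
          + K₂ * betaInt (decayExp n ρ) (κ * ρ + μ₂) * |t| ^ (1 - decayExp n ρ - (κ * ρ + μ₂)))
        * e ^ ((ρ + 1) / (ρ + 2)) := by
  have ht0 := abs_pos.2 ht
  set σ := decayExp n ρ with hσdef
  set c := pairingConst ((ρ + 2) / (ρ + 1)) with hc
  set P : ℝ → ℂ := fun s => duhamelPairing ρ u t s ψ - duhamelPairing ρ v t s ψ with hP
  -- The substitution treats both signs of `t` at once.
  have hscale : ∫ s in (0 : ℝ)..t, P s = t • ∫ τ in (0 : ℝ)..1, P (t * τ) := by
    rw [intervalIntegral.smul_integral_comp_mul_left, mul_zero, mul_one]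
  let G : ℝ → ℝ := fun τ => c * lipConst ρ * A ^ ρ * e ^ ((ρ + 1) / (ρ + 2)) *
    (K₁ * |t| ^ (-σ - (κ * ρ + μ₁)) * ((1 - τ) ^ (-σ) * τ ^ (-(κ * ρ + μ₁)))
      + K₂ * |t| ^ (-σ - (κ * ρ + μ₂)) * ((1 - τ) ^ (-σ) * τ ^ (-(κ * ρ + μ₂))))
  have hi₁ := (intervalIntegrable_betaInt hσ hμ₁).const_mul (K₁ * |t| ^ (-σ - (κ * ρ + μ₁)))
  have hi₂ := (intervalIntegrable_betaInt hσ hμ₂).const_mul (K₂ * |t| ^ (-σ - (κ * ρ + μ₂)))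
  have hGi : IntervalIntegrable G volume 0 1 := (hi₁.add hi₂).const_mul _
  have hpt : ∀ᵐ τ : ℝ, τ ∈ Ioc (0 : ℝ) 1 → ‖P (t * τ)‖ ≤ G τ := by
    have hne : ∀ᵐ τ : ℝ, τ ≠ 1 := by simp [ae_iff, measure_singleton]
    filter_upwards [hne] with τ hτ1 hτ
    have hτ0 : 0 < τ := hτ.1
    have hτ1' : 0 < 1 - τ := by
      have := lt_of_le_of_ne hτ.2 hτ1
      linarith
    have hs0 : t * τ ≠ 0 := mul_ne_zero ht hτ0.ne'
    have habs : |t * τ| = |t| * τ := by rw [abs_mul, abs_of_pos hτ0]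
    have hst : |t * τ| ≤ |t| := by rw [habs]; exact mul_le_of_le_one_right ht0.le hτ.2
    have htst : t - t * τ = t * (1 - τ) := by ring
    have hts : t - t * τ ≠ 0 := by rw [htst]; exact mul_ne_zero ht hτ1'.ne'
    have habs' : |t - t * τ| = |t| * (1 - τ) := by rw [htst, abs_mul, abs_of_pos hτ1']
    have hs0' := abs_pos.2 hs0
    refine (norm_duhamelPairing_sub_le hρ (by positivity) (by positivity) he hts (hum _ hs0 hst)
      (hvm _ hs0 hst) (hu _ hs0 hst) (hv _ hs0 hst) (huv _ hs0 hst) ψ h1 h2).trans (le_of_eq ?_)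
    have e1 : (A * |t * τ| ^ (-κ)) ^ ρ = A ^ ρ * |t| ^ (-(κ * ρ)) * τ ^ (-(κ * ρ)) := by
      rw [habs, Real.mul_rpow hA.le (by positivity), ← Real.rpow_mul (by positivity),
        Real.mul_rpow ht0.le hτ0.le, neg_mul, mul_assoc]
    have e2 : ∀ μ, |t| ^ (-σ - (κ * ρ + μ)) = |t| ^ (-σ) * |t| ^ (-(κ * ρ)) * |t| ^ (-μ) :=
      fun μ => by rw [← Real.rpow_add ht0, ← Real.rpow_add ht0]; congr 1; ring
    have e3 : ∀ μ, τ ^ (-(κ * ρ + μ)) = τ ^ (-(κ * ρ)) * τ ^ (-μ) :=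
      fun μ => by rw [← Real.rpow_add hτ0]; congr 1; ring
    simp only [G]
    rw [e1, e2, e2, e3, e3, habs', habs, Real.mul_rpow ht0.le hτ1'.le,
      Real.mul_rpow ht0.le hτ0.le, Real.mul_rpow ht0.le hτ0.le]
    ring
  have hint : ∫ τ in (0 : ℝ)..1, G τ = c * lipConst ρ * A ^ ρ * e ^ ((ρ + 1) / (ρ + 2)) *
      (K₁ * |t| ^ (-σ - (κ * ρ + μ₁)) * betaInt σ (κ * ρ + μ₁)
        + K₂ * |t| ^ (-σ - (κ * ρ + μ₂)) * betaInt σ (κ * ρ + μ₂)) := by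
    simp only [G]
    rw [intervalIntegral.integral_const_mul, intervalIntegral.integral_add hi₁ hi₂,
      intervalIntegral.integral_const_mul, intervalIntegral.integral_const_mul, betaInt, betaInt]
  have hle := intervalIntegral.norm_integral_le_of_norm_le zero_le_one hpt hGi
  rw [hint] at hle
  rw [hscale, norm_smul, Real.norm_eq_abs]
  refine (mul_le_mul_of_nonneg_left hle ht0.le).trans (le_of_eq ?_)
  have e4 : ∀ μ, |t| ^ (1 - σ - (κ * ρ + μ)) = |t| * |t| ^ (-σ - (κ * ρ + μ)) := fun μ => by
    rw [show 1 - σ - (κ * ρ + μ) = 1 + (-σ - (κ * ρ + μ)) by ring, Real.rpow_add ht0,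
      Real.rpow_one]
  rw [e4, e4]
  ring

/-- Subtracting the two equations and the linear part `w` leaves a pure Duhamel term. Its pairings
give a weak bound by duality, and `w` is then added back at the cost of a factor 2. -/
theorem IsMildSolution.distrBound_sub {n : ℕ} {ρ γ L A κ K₁ μ₁ K₂ μ₂ t : ℝ} {lam : ℂ}
    {T T' : ℝ≥0∞} {φ φ' : 𝓢'(Space n, ℂ)} {u v : ℝ → Space n → ℂ} {w : Space n → ℂ} (hρ : 0 < ρ)
    (hu : IsMildSolution ρ lam γ T φ u) (hv : IsMildSolution ρ lam γ T' φ' v)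
    (ht : t ∈ times T) (ht' : t ∈ times T') (hwm : AEStronglyMeasurable w volume)
    (hw : Represents (distSchrodinger t (φ - φ')) w) (hL : 0 < L) (hwL : DistrBound (ρ + 2) L w)
    (hA : 0 < A) (hK₁ : 0 < K₁) (hK₂ : 0 ≤ K₂)
    (hσ : decayExp n ρ < 1) (hμ₁ : κ * ρ + μ₁ < 1) (hμ₂ : κ * ρ + μ₂ < 1)
    (huA : ∀ s, s ≠ 0 → |s| ≤ |t| → DistrBound (ρ + 2) (A * |s| ^ (-κ)) (u s))
    (hvA : ∀ s, s ≠ 0 → |s| ≤ |t| → DistrBound (ρ + 2) (A * |s| ^ (-κ)) (v s))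
    (huv : ∀ s, s ≠ 0 → |s| ≤ |t| →
      DistrBound (ρ + 2) (K₁ * |s| ^ (-μ₁) + K₂ * |s| ^ (-μ₂)) fun x => u s x - v s x) :
    DistrBound (ρ + 2) (2 * (duhamelConst ρ lam * A ^ ρ *
        (K₁ * (betaInt (decayExp n ρ) (κ * ρ + μ₁) + 1) * |t| ^ (1 - decayExp n ρ - (κ * ρ + μ₁))
          + K₂ * betaInt (decayExp n ρ) (κ * ρ + μ₂) * |t| ^ (1 - decayExp n ρ - (κ * ρ + μ₂)))
        + L)) fun x => u t x - v t x := by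
  have ht0 := abs_pos.2 ht.1
  have hp : 1 < ρ + 2 := by linarith
  set σ := decayExp n ρ with hσdef
  have hum : ∀ s, s ≠ 0 → |s| ≤ |t| → AEStronglyMeasurable (u s) volume := fun s hs hst =>
    hu.mem.aestronglyMeasurable s (mem_times_of_abs_le ht hs hst)
  have hvm : ∀ s, s ≠ 0 → |s| ≤ |t| → AEStronglyMeasurable (v s) volume := fun s hs hst =>
    hv.mem.aestronglyMeasurable s (mem_times_of_abs_le ht' hs hst)
  have hut := huA t ht.1 le_rfl
  have hvt := hvA t ht.1 le_rfl
  have hutm := hum t ht.1 le_rfl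
  have hvtm := hvm t ht.1 le_rfl
  have hAt : 0 < A * |t| ^ (-κ) := by positivity
  set X := K₁ * betaInt σ (κ * ρ + μ₁) * |t| ^ (1 - σ - (κ * ρ + μ₁))
    + K₂ * betaInt σ (κ * ρ + μ₂) * |t| ^ (1 - σ - (κ * ρ + μ₂)) with hX
  -- The `+ 1` makes the bound strictly positive, as the duality lemma requires, without proving the
  -- Beta integral positive.
  set Y := K₁ * (betaInt σ (κ * ρ + μ₁) + 1) * |t| ^ (1 - σ - (κ * ρ + μ₁))
    + K₂ * betaInt σ (κ * ρ + μ₂) * |t| ^ (1 - σ - (κ * ρ + μ₂)) with hY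
  have hb₁ := betaInt_nonneg σ (κ * ρ + μ₁)
  have hb₂ := betaInt_nonneg σ (κ * ρ + μ₂)
  have hXY : X ≤ Y := by rw [hX, hY]; gcongr; linarith
  have hX0 : 0 ≤ X := by positivity
  have hY0 : 0 < Y := by positivity
  have hCpos := duhamelConst_pos hρ lam
  have hcl : 0 < pairingConst ((ρ + 2) / (ρ + 1)) * lipConst ρ := by
    have h1 : 0 < ‖lam‖ + 1 := by positivity
    unfold duhamelConst at hCpos
    exact pos_of_mul_pos_right (pos_of_mul_pos_right hCpos two_pos.le) h1.le
  have hK0 : 0 < duhamelConst ρ lam * A ^ ρ * Y := by positivity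
  have hgm : AEStronglyMeasurable (fun x => u t x - v t x - w x) volume :=
    (hutm.sub hvtm).sub hwm
  have hgb := ((hut.sub hp.le hAt.le hAt.le hvt).sub hp.le (by positivity) hL.le hwL)
  have hgl := hgb.locallyIntegrable hp (by positivity) hgm
  have key : DistrBound (ρ + 2) (2 * (duhamelConst ρ lam / 2 * A ^ ρ * Y))
      fun x => u t x - v t x - w x := by
    refine distrBound_of_pairing hp (by positivity) hgm hgl fun e ψ he h1 h2 => ?_
    have hiu := hut.integrable_mul_schwartz hp hAt hutm ψ
    have hiv := hvt.integrable_mul_schwartz hp hAt hvtm ψ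
    have heq : ∫ x, (u t x - v t x - w x) * ψ x = -(Complex.I * lam *
        ∫ s in (0 : ℝ)..t, (duhamelPairing ρ u t s ψ - duhamelPairing ρ v t s ψ)) := by
      simp only [sub_mul]
      rw [integral_sub (f := fun x => u t x * ψ x - v t x * ψ x) (hiu.sub hiv) (hw ψ).1,
        integral_sub hiu hiv, ← (hw ψ).2,
        hu.integral_equation t ht ψ, hv.integral_equation t ht' ψ,
        intervalIntegral.integral_sub (hu.duhamel_integrable t ht ψ)
          (hv.duhamel_integrable t ht' ψ), map_sub,
        show (distSchrodinger t φ - distSchrodinger t φ') ψ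
          = distSchrodinger t φ ψ - distSchrodinger t φ' ψ from rfl]
      ring
    rw [heq, norm_neg, norm_mul, norm_mul, Complex.norm_I, one_mul]
    have hmain := norm_integral_duhamelPairing_sub_le hρ hA hK₁ hK₂ he hσ hμ₁ hμ₂ ht.1 hum hvm
      huA hvA huv ψ h1 h2
    rw [← hσdef, ← hX] at hmain
    rw [show 1 - 1 / (ρ + 2) = (ρ + 1) / (ρ + 2) by field_simp; ring]
    have he' : 0 < e ^ ((ρ + 1) / (ρ + 2)) := by positivity
    calc _ ≤ (‖lam‖ + 1) * (pairingConst ((ρ + 2) / (ρ + 1)) * lipConst ρ * A ^ ρ * Y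
          * e ^ ((ρ + 1) / (ρ + 2))) := by
          refine mul_le_mul (by linarith) (hmain.trans ?_) (norm_nonneg _) (by positivity)
          gcongr
      _ = _ := by unfold duhamelConst; ring
  have hsum := key.add hp.le (by positivity) hL.le hwL
  simp only [sub_add_cancel] at hsum
  rwa [show 2 * (duhamelConst ρ lam / 2 * A ^ ρ * Y) = duhamelConst ρ lam * A ^ ρ * Y by ring]
    at hsum

/-! ### Weighted decay -/

theorem le_ofReal_mul_rpow_neg {r γ A : ℝ} {x : ℝ≥0∞} (hr : 0 < r)
    (h : ENNReal.ofReal (r ^ γ) * x ≤ ENNReal.ofReal A) : x ≤ ENNReal.ofReal (A * r ^ (-γ)) := by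
  have h1 := mul_le_mul_right h (ENNReal.ofReal (r ^ (-γ)))
  rwa [← mul_assoc, ← ENNReal.ofReal_mul (by positivity), ← Real.rpow_add hr, neg_add_cancel,
    Real.rpow_zero, ENNReal.ofReal_one, one_mul, ← ENNReal.ofReal_mul (by positivity),
    mul_comm] at h1

theorem lt_ofReal_mul_rpow_neg {r γ A : ℝ} {x : ℝ≥0∞} (hr : 0 < r)
    (h : ENNReal.ofReal (r ^ γ) * x < ENNReal.ofReal A) : x < ENNReal.ofReal (A * r ^ (-γ)) := by
  by_contra hcon
  refine h.not_ge ?_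
  refine le_trans (le_of_eq ?_) (mul_le_mul_right (not_lt.1 hcon) _)
  rw [← ENNReal.ofReal_mul (by positivity), mul_left_comm, ← Real.rpow_add hr, add_neg_cancel,
    Real.rpow_zero, mul_one]

theorem exists_distrBound_of_distWeakNorm_lt {n : ℕ} {p L : ℝ} {φ : 𝓢'(Space n, ℂ)} (hp : 0 < p)
    (hL : 0 ≤ L) (h : distWeakNorm p φ < ENNReal.ofReal L) :
    ∃ w : Space n → ℂ, AEStronglyMeasurable w volume ∧ Represents φ w ∧ DistrBound p L w := by
  simp only [distWeakNorm, iInf_lt_iff] at h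
  obtain ⟨w, hw, hφ, hlt⟩ := h
  exact ⟨w, hw, hφ, distrBound_of_weakNorm_le hp hL hlt.le⟩

theorem distrBound_of_spaceNorm_le {n : ℕ} {p γ A t : ℝ} {T : ℝ≥0∞} {u : ℝ → Space n → ℂ}
    (hp : 0 < p) (hA : 0 ≤ A) (h : spaceNorm p γ T u ≤ ENNReal.ofReal A) (ht : t ∈ times T) :
    DistrBound p (A * |t| ^ (-γ)) (u t) :=
  distrBound_of_weakNorm_le hp (by positivity) (le_ofReal_mul_rpow_neg (abs_pos.2 ht.1)
    ((le_iSup₂ (f := fun (t : ℝ) (_ : t ∈ times T) =>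
      ENNReal.ofReal (|t| ^ γ) * weakNorm p (u t)) t ht).trans h))

theorem Represents.sub {n : ℕ} {φ φ' : 𝓢'(Space n, ℂ)} {f f' : Space n → ℂ}
    (h : Represents φ f) (h' : Represents φ' f') : Represents (φ - φ') fun x => f x - f' x := by
  intro ψ
  simp only [sub_mul]
  refine ⟨(h ψ).1.sub (h' ψ).1, ?_⟩
  rw [integral_sub (h ψ).1 (h' ψ).1, ← (h ψ).2, ← (h' ψ).2]
  rfl

theorem tendsto_weakNorm_of_distrBound {n : ℕ} {p μ : ℝ} {F : Filter ℝ} {f : ℝ → Space n → ℂ}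
    (hp : 1 < p) (hF : ∀ᶠ t in F, t ≠ 0)
    (h : ∀ η : ℝ, 0 < η → ∀ᶠ t in F, DistrBound p (η * |t| ^ (-μ)) (f t)) :
    Tendsto (fun t => ENNReal.ofReal (|t| ^ μ) * weakNorm p (f t)) F (𝓝 0) := by
  have hc : 0 < p / (p - 1) := div_pos (by linarith) (by linarith)
  rw [ENNReal.tendsto_nhds_zero]
  intro ε hε
  obtain ⟨η, hη, hηε⟩ : ∃ η : ℝ, 0 < η ∧ ENNReal.ofReal (p / (p - 1) * η) ≤ ε := by
    obtain ⟨r, hr0, hr⟩ := ENNReal.lt_iff_exists_nnreal_btwn.1 hε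
    have hr0' : (0 : ℝ) < r := by exact_mod_cast hr0
    refine ⟨r / (p / (p - 1)), by positivity, ?_⟩
    rw [mul_div_cancel₀ _ hc.ne', ENNReal.ofReal_coe_nnreal]
    exact hr.le
  filter_upwards [hF, h η hη] with t ht hb
  have ht0 := abs_pos.2 ht
  refine le_trans ((mul_le_mul_right (hb.weakNorm_le hp (by positivity)) _).trans
    (le_of_eq ?_)) hηε
  rw [← ENNReal.ofReal_mul (by positivity)]
  congr 1
  rw [Real.rpow_neg ht0.le]
  field_simp

theorem eventually_exists_distrBound {n : ℕ} {p μ : ℝ} {F : Filter ℝ}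
    {Φ : ℝ → 𝓢'(Space n, ℂ)} (hp : 0 < p) (hF : ∀ᶠ t in F, t ≠ 0)
    (h : Tendsto (fun t => ENNReal.ofReal (|t| ^ μ) * distWeakNorm p (Φ t)) F (𝓝 0))
    {η : ℝ} (hη : 0 < η) :
    ∀ᶠ t in F, ∃ w : Space n → ℂ, AEStronglyMeasurable w volume ∧ Represents (Φ t) w ∧
      DistrBound p (η * |t| ^ (-μ)) w := by
  filter_upwards [hF, h.eventually_lt_const (ENNReal.ofReal_pos.2 hη)] with t ht hlt
  exact exists_distrBound_of_distWeakNorm_lt hp (by positivity)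
    (lt_ofReal_mul_rpow_neg (abs_pos.2 ht) hlt)

theorem eventually_comap_abs_atTop {P : ℝ → Prop} :
    (∀ᶠ t in comap (fun t : ℝ => |t|) atTop, P t) ↔ ∃ R : ℝ, 0 < R ∧ ∀ t, R ≤ |t| → P t := by
  rw [eventually_comap, eventually_atTop]
  constructor
  · rintro ⟨R, hR⟩
    exact ⟨max R 1, by positivity, fun t ht => hR _ ((le_max_left _ _).trans ht) t rfl⟩
  · rintro ⟨R, -, hR⟩
    exact ⟨R, fun b hb t ht => hR t (ht ▸ hb)⟩

theorem eventually_punctured_nhds_zero {P : ℝ → Prop} :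
    (∀ᶠ t in 𝓝[≠] (0 : ℝ), P t) ↔ ∃ r : ℝ, 0 < r ∧ ∀ t, t ≠ 0 → |t| ≤ r → P t := by
  rw [eventually_nhdsWithin_iff, Metric.eventually_nhds_iff]
  constructor
  · rintro ⟨r, hr, h⟩
    refine ⟨r / 2, by positivity, fun t ht htr => h ?_ ht⟩
    rw [Real.dist_eq, sub_zero]
    linarith
  · rintro ⟨r, hr, h⟩
    refine ⟨r, hr, fun t htr ht => h t ht ?_⟩
    rw [Real.dist_eq, sub_zero] at htr
    exact htr.le

theorem DistrBound.sub_same {n : ℕ} {p A : ℝ} {f g : Space n → ℂ} (hp : 1 ≤ p) (hA : 0 ≤ A)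
    (hf : DistrBound p A f) (hg : DistrBound p A g) :
    DistrBound p (4 * A) fun x => f x - g x := by
  have := hf.sub hp hA hA hg
  rwa [show 2 * (A + A) = 4 * A by ring] at this

/-! ### Asymptotic stability -/

theorem asymptotic_stability {n : ℕ} {ρ h : ℝ} (hρ : 0 < ρ) (lam : ℂ)
    (hn : n * ρ / 2 < ρ + 2) (hh : 0 ≤ h) (hh1 : h < 1 - alpha n ρ / 2 * (ρ + 1)) :
    ∃ ε₀ : ℝ, 0 < ε₀ ∧ ∀ ε : ℝ, 0 < ε → ε ≤ ε₀ →
      ∀ (φ φ' : 𝓢'(Space n, ℂ)) (u v : ℝ → Space n → ℂ),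
        IsSmallGlobalSolution ρ lam ε φ u → IsSmallGlobalSolution ρ lam ε φ' v →
        Tendsto (fun t : ℝ => ENNReal.ofReal (|t| ^ (alpha n ρ / 2 + h)) *
          distWeakNorm (ρ + 2) (distSchrodinger t (φ - φ')))
          (comap (fun t : ℝ => |t|) atTop) (𝓝 0) →
        Tendsto (fun t : ℝ => ENNReal.ofReal (|t| ^ (alpha n ρ / 2 + h)) *
          weakNorm (ρ + 2) (fun x => u t x - v t x))
          (comap (fun t : ℝ => |t|) atTop) (𝓝 0) := by
  have hp : 1 < ρ + 2 := by linarith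
  have hp0 : 0 < ρ + 2 := by linarith
  set κ := alpha n ρ / 2 with hκ
  set σ := decayExp n ρ with hσdef
  have hσ : σ < 1 := by
    rw [hσdef, decayExp, div_lt_one (by positivity)]; linarith
  -- Scale invariance of `E_α`: the Duhamel term preserves every admissible power of `|t|`.
  have hσκ : σ + κ * ρ = 1 := by
    rw [hσdef, hκ, decayExp, alpha]; field_simp; ring
  set μ := κ + h with hμ
  have hμ1 : κ * ρ + μ < 1 := by rw [hμ]; linarith
  -- Half of the room left by `hh1`: the steeper weight `|s|^{-(μ+θ)}` still gives a convergent Beta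
  -- integral.
  set θ := (1 - (κ * ρ + μ)) / 2 with hθ
  have hθ0 : 0 < θ := by rw [hθ]; linarith
  have hμ2 : κ * ρ + (μ + θ) < 1 := by rw [hθ]; linarith
  set C := duhamelConst ρ lam with hC
  have hC0 : 0 < C := duhamelConst_pos hρ lam
  set B := betaInt σ (κ * ρ + μ) + 1 with hB
  have hB0 : 0 < B := by have := betaInt_nonneg σ (κ * ρ + μ); linarith
  set B' := betaInt σ (κ * ρ + (μ + θ)) with hB'
  have hB'0 : 0 ≤ B' := betaInt_nonneg _ _
  -- Chosen so that `A = 2ε` satisfies `C A^ρ B ≤ 1/4`; with the quasi-triangle factor the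
  -- contraction constant is `1/2`.
  refine ⟨(1 / (4 * C * B)) ^ (1 / ρ) / 2, by positivity, ?_⟩
  intro ε hε hεε₀ φ φ' u v hu hv hlim
  set A := 2 * ε with hA
  have hA0 : 0 < A := by positivity
  have hAρ : A ^ ρ ≤ 1 / (4 * C * B) := by
    have h1 : A ≤ (1 / (4 * C * B)) ^ (1 / ρ) := by rw [hA]; linarith
    have h2 := Real.rpow_le_rpow hA0.le h1 hρ.le
    rwa [← Real.rpow_mul (by positivity), one_div_mul_cancel hρ.ne', Real.rpow_one] at h2
  have hCAB : 2 * (C * A ^ ρ * B) ≤ 1 / 2 := by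
    have h1 : C * A ^ ρ * B ≤ C * (1 / (4 * C * B)) * B := by gcongr
    have h2 : C * (1 / (4 * C * B)) * B = 1 / 4 := by field_simp
    linarith
  have htimes : ∀ t : ℝ, t ≠ 0 → t ∈ times ∞ := fun t ht => ⟨ht, ENNReal.ofReal_lt_top⟩
  have hub : ∀ s : ℝ, s ≠ 0 → DistrBound (ρ + 2) (A * |s| ^ (-κ)) (u s) := fun s hs =>
    distrBound_of_spaceNorm_le hp0 hA0.le hu.norm_le (htimes s hs)
  have hvb : ∀ s : ℝ, s ≠ 0 → DistrBound (ρ + 2) (A * |s| ^ (-κ)) (v s) := fun s hs =>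
    distrBound_of_spaceNorm_le hp0 hA0.le hv.norm_le (htimes s hs)
  have hF : ∀ᶠ t in comap (fun t : ℝ => |t|) atTop, t ≠ 0 :=
    eventually_comap_abs_atTop.2 ⟨1, one_pos, fun t ht h0 => by norm_num [h0] at ht⟩
  have hev := fun η (hη : 0 < η) => eventually_exists_distrBound hp0 hF hlim hη
  set M := 2 * (C * A ^ ρ * B') with hM
  have hM0 : 0 ≤ M := by positivity
  have hstep : ∀ t : ℝ, t ≠ 0 → ∀ K K₂ L : ℝ, 0 < K → 0 ≤ K₂ → 0 < L →
      (∃ w : Space n → ℂ, AEStronglyMeasurable w volume ∧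
        Represents (distSchrodinger t (φ - φ')) w ∧ DistrBound (ρ + 2) (L * |t| ^ (-μ)) w) →
      (∀ s : ℝ, s ≠ 0 → |s| ≤ |t| → DistrBound (ρ + 2)
        (K * |s| ^ (-μ) + K₂ * |s| ^ (-(μ + θ))) fun x => u s x - v s x) →
      DistrBound (ρ + 2) ((K / 2 + M * K₂ * |t| ^ (-θ) + 2 * L) * |t| ^ (-μ))
        fun x => u t x - v t x := by
    rintro t ht K K₂ L hK hK₂ hL ⟨w, hwm, hw, hwL⟩ hD
    have ht0 := abs_pos.2 ht
    have := hu.mild.distrBound_sub hρ hv.mild (htimes t ht) (htimes t ht) hwm hw (by positivity)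
      hwL hA0 hK hK₂ hσ hμ1 hμ2 (fun s hs _ => hub s hs) (fun s hs _ => hvb s hs) hD
    rw [← hC, ← hσdef, ← hB, ← hB', show 1 - σ - (κ * ρ + μ) = -μ by linarith,
      show 1 - σ - (κ * ρ + (μ + θ)) = -θ + -μ by linarith, Real.rpow_add ht0] at this
    refine this.mono hp0.le (by positivity) ?_
    have e1 : 2 * (C * A ^ ρ * (K * B * |t| ^ (-μ) + K₂ * B' * (|t| ^ (-θ) * |t| ^ (-μ)))
        + L * |t| ^ (-μ)) = (2 * (C * A ^ ρ * B) * K + M * K₂ * |t| ^ (-θ) + 2 * L)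
          * |t| ^ (-μ) := by rw [hM]; ring
    rw [e1]
    gcongr
    nlinarith
  obtain ⟨R₀, hR₀, hlinR₀⟩ := eventually_comap_abs_atTop.1 (hev 1 one_pos)
  -- The limit hypothesis gives the `1` for `|t| ≥ R₀`; for `|t| ≤ R₀` smallness of both data gives
  -- `4ε|t|^h`, using `h ≥ 0`.
  set L := 1 + 4 * ε * R₀ ^ h with hL
  have hL0 : 0 < L := by positivity
  have hsmall : ∀ (ψ : 𝓢'(Space n, ℂ)), (⨆ t : ℝ, ⨆ _ : t ≠ 0, ENNReal.ofReal (|t| ^ κ) *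
      distWeakNorm (ρ + 2) (distSchrodinger t ψ)) < ENNReal.ofReal ε → ∀ t : ℝ, t ≠ 0 →
      ∃ w : Space n → ℂ, AEStronglyMeasurable w volume ∧ Represents (distSchrodinger t ψ) w ∧
        DistrBound (ρ + 2) (ε * |t| ^ (-κ)) w := fun ψ hψ t ht =>
    exists_distrBound_of_distWeakNorm_lt hp0 (by positivity) (lt_ofReal_mul_rpow_neg
      (abs_pos.2 ht) ((le_iSup₂ (f := fun (t : ℝ) (_ : t ≠ 0) => ENNReal.ofReal (|t| ^ κ) *
        distWeakNorm (ρ + 2) (distSchrodinger t ψ)) t ht).trans_lt hψ))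
  have hlin : ∀ t : ℝ, t ≠ 0 → ∃ w : Space n → ℂ, AEStronglyMeasurable w volume ∧
      Represents (distSchrodinger t (φ - φ')) w ∧ DistrBound (ρ + 2) (L * |t| ^ (-μ)) w := by
    intro t ht
    have ht0 := abs_pos.2 ht
    rcases le_total R₀ |t| with hle | hle
    · obtain ⟨w, h1, h2, h3⟩ := hlinR₀ t hle
      refine ⟨w, h1, h2, h3.mono hp0.le (by positivity) ?_⟩
      gcongr
      rw [hL]
      have : 0 ≤ 4 * ε * R₀ ^ h := by positivity
      linarith
    · obtain ⟨w, h1, h2, h3⟩ := hsmall φ hu.small t ht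
      obtain ⟨w', h1', h2', h3'⟩ := hsmall φ' hv.small t ht
      refine ⟨fun x => w x - w' x, h1.sub h1', by rw [map_sub]; exact h2.sub h2',
        (h3.sub_same hp.le (by positivity) h3').mono hp0.le (by positivity) ?_⟩
      have e1 : |t| ^ (-κ) = |t| ^ h * |t| ^ (-μ) := by
        rw [← Real.rpow_add ht0]; congr 1; rw [hμ]; ring
      rw [e1, hL]
      have e2 : |t| ^ h ≤ R₀ ^ h := Real.rpow_le_rpow ht0.le hle hh
      have e3 : 0 < |t| ^ (-μ) := by positivity
      have e4 : 4 * (ε * (|t| ^ h * |t| ^ (-μ))) = 4 * ε * |t| ^ h * |t| ^ (-μ) := by ring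
      rw [e4]
      gcongr
      have : 4 * ε * |t| ^ h ≤ 4 * ε * R₀ ^ h := by gcongr
      linarith
  -- Up to time `|s₀|` the a priori bounds give a constant `K₀` depending on `s₀`. The map `K ↦ K/2
  -- + 2L` has fixed point `4L`, so iterating removes this dependence.
  have hunif : ∀ s : ℝ, s ≠ 0 → DistrBound (ρ + 2) ((4 * L + 1) * |s| ^ (-μ))
      fun x => u s x - v s x := by
    intro s₀ hs₀
    have hs₀' := abs_pos.2 hs₀
    set K₀ := 4 * A * |s₀| ^ h with hK₀
    have hK₀0 : 0 < K₀ := by positivity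
    have hind : ∀ k : ℕ, ∀ s : ℝ, s ≠ 0 → |s| ≤ |s₀| →
        DistrBound (ρ + 2) ((4 * L + K₀ / 2 ^ k) * |s| ^ (-μ)) fun x => u s x - v s x := by
      intro k
      induction k with
      | zero =>
        intro s hs hss₀
        have hs0 := abs_pos.2 hs
        refine ((hub s hs).sub_same hp.le (by positivity) (hvb s hs)).mono hp0.le
          (by positivity) ?_
        have e1 : |s| ^ (-κ) = |s| ^ h * |s| ^ (-μ) := by
          rw [← Real.rpow_add hs0]; congr 1; rw [hμ]; ring
        have e2 : |s| ^ h ≤ |s₀| ^ h := Real.rpow_le_rpow hs0.le hss₀ hh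
        have e4 : 4 * (A * (|s| ^ h * |s| ^ (-μ))) = 4 * A * |s| ^ h * |s| ^ (-μ) := by ring
        rw [e1, e4, pow_zero, div_one]
        gcongr
        have : 4 * A * |s| ^ h ≤ 4 * A * |s₀| ^ h := by gcongr
        linarith
      | succ k ih =>
        intro s hs hss₀
        have := hstep s hs (4 * L + K₀ / 2 ^ k) 0 L (by positivity) le_rfl hL0 (hlin s hs)
          fun r hr hrs => by
            rw [zero_mul, add_zero]
            exact ih r hr (hrs.trans hss₀)
        convert this using 2
        rw [pow_succ]
        field_simp
        ring
    obtain ⟨k, hk⟩ := exists_nat_gt K₀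
    refine (hind k s₀ hs₀ le_rfl).mono hp0.le (by positivity) ?_
    gcongr
    rw [div_le_one (by positivity)]
    have : (k : ℝ) ≤ 2 ^ k := by exact_mod_cast Nat.lt_two_pow_self.le
    linarith
  set K := 4 * L + 1 with hK
  have hK0 : 0 < K := by positivity
  -- Beyond `R` the improved constant `Λ` holds. Before `R` the uniform bound is rewritten with the
  -- steeper weight, whose Duhamel contribution carries an extra `|t|^{-θ}`.
  have hdecay : ∀ j : ℕ, ∀ᶠ t in comap (fun t : ℝ => |t|) atTop,
      DistrBound (ρ + 2) (K * (3 / 4) ^ j * |t| ^ (-μ)) fun x => u t x - v t x := by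
    intro j
    induction j with
    | zero =>
      filter_upwards [hF] with t ht
      simpa using hunif t ht
    | succ j ih =>
      obtain ⟨R, hR, hRb⟩ := eventually_comap_abs_atTop.1 ih
      set Λ := K * (3 / 4) ^ j with hΛ
      have hΛ0 : 0 < Λ := by positivity
      have hDall : ∀ s : ℝ, s ≠ 0 → DistrBound (ρ + 2)
          (Λ * |s| ^ (-μ) + K * R ^ θ * |s| ^ (-(μ + θ))) fun x => u s x - v s x := by
        intro s hs
        have hs0 := abs_pos.2 hs
        rcases le_total R |s| with hle | hle
        · exact (hRb s hle).mono hp0.le (by positivity) (le_add_of_nonneg_right (by positivity))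
        · refine (hunif s hs).mono hp0.le (by positivity)
            (le_trans ?_ (le_add_of_nonneg_left (by positivity)))
          have e1 : |s| ^ (-μ) = |s| ^ θ * |s| ^ (-(μ + θ)) := by
            rw [← Real.rpow_add hs0]; congr 1; ring
          have e2 : |s| ^ θ ≤ R ^ θ := Real.rpow_le_rpow hs0.le hle hθ0.le
          rw [e1, ← mul_assoc]
          gcongr
      have htail : ∀ᶠ t in comap (fun t : ℝ => |t|) atTop,
          M * (K * R ^ θ) * |t| ^ (-θ) < Λ / 8 := by
        have h1 : Tendsto (fun t : ℝ => M * (K * R ^ θ) * |t| ^ (-θ))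
            (comap (fun t : ℝ => |t|) atTop) (𝓝 (M * (K * R ^ θ) * 0)) :=
          (((tendsto_rpow_neg_atTop hθ0).comp tendsto_comap)).const_mul _
        rw [mul_zero] at h1
        exact h1.eventually_lt_const (by positivity)
      -- The three contributions are `Λ/2`, `Λ/8` and `2 · Λ/16`, in total `3Λ/4`.
      filter_upwards [hF, htail, hev (Λ / 16) (by positivity)] with t ht htl hw
      refine (hstep t ht Λ (K * R ^ θ) (Λ / 16) hΛ0 (by positivity) (by positivity) hw
        fun s hs _ => hDall s hs).mono hp0.le (by positivity) ?_
      rw [show K * (3 / 4) ^ (j + 1) = 3 / 4 * Λ by rw [hΛ, pow_succ]; ring]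
      gcongr
      linarith
  refine tendsto_weakNorm_of_distrBound hp hF fun η hη => ?_
  obtain ⟨j, hj⟩ := exists_pow_lt_of_lt_one (div_pos hη hK0) (by norm_num : (3 / 4 : ℝ) < 1)
  filter_upwards [hdecay j] with t hb
  refine hb.mono hp0.le (by positivity) ?_
  gcongr
  rw [lt_div_iff₀ hK0] at hj
  linarith

/-! ### Behaviour at the initial time -/

theorem behaviour_at_zero {n : ℕ} {ρ h : ℝ} (hρ : 0 < ρ) {lam : ℂ}
    (hn : n * ρ / 2 < (ρ + 2) / (ρ + 1))
    (hh : -(1 - (alpha n ρ - beta n ρ) / 2 * (ρ + 1)) < h) {T T' : ℝ≥0∞} (hT : 0 < T)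
    (hT' : 0 < T') {φ φ' : 𝓢'(Space n, ℂ)} {u v : ℝ → Space n → ℂ}
    (hu : IsMildSolution ρ lam ((alpha n ρ - beta n ρ) / 2) T φ u)
    (hv : IsMildSolution ρ lam ((alpha n ρ - beta n ρ) / 2) T' φ' v)
    (hlim : Tendsto (fun t : ℝ => ENNReal.ofReal (|t| ^ ((alpha n ρ - beta n ρ) / 2 - h)) *
      distWeakNorm (ρ + 2) (distSchrodinger t (φ - φ'))) (𝓝[≠] 0) (𝓝 0)) :
    Tendsto (fun t : ℝ => ENNReal.ofReal (|t| ^ ((alpha n ρ - beta n ρ) / 2 - h)) *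
      weakNorm (ρ + 2) (fun x => u t x - v t x)) (𝓝[≠] 0) (𝓝 0) := by
  have hp : 1 < ρ + 2 := by linarith
  have hp0 : 0 < ρ + 2 := by linarith
  -- The weight of `E_{α,β}^T` is exactly the linear decay rate from `L^{(q,∞)}`, so here `κ = σ`.
  have hσeq : (alpha n ρ - beta n ρ) / 2 = decayExp n ρ := by
    rw [alpha, beta, decayExp]; field_simp; ring
  rw [hσeq] at hh hu hv hlim ⊢
  set σ := decayExp n ρ with hσdef
  set δ := 1 - σ * (ρ + 1) with hδ
  have hσ0 : 0 ≤ σ := by rw [hσdef, decayExp]; positivity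
  have hδ0 : 0 < δ := by
    have h1 : σ * (ρ + 1) < 1 := by
      rw [lt_div_iff₀ (by linarith)] at hn
      rw [hσdef, decayExp, div_mul_eq_mul_div, div_lt_one (by positivity)]
      linarith
    linarith
  have hσ : σ < 1 := by nlinarith
  set A := max (spaceNorm (ρ + 2) σ T u).toReal (spaceNorm (ρ + 2) σ T' v).toReal + 1 with hA
  have hA0 : 0 < A := by
    have : 0 ≤ max (spaceNorm (ρ + 2) σ T u).toReal (spaceNorm (ρ + 2) σ T' v).toReal :=
      le_max_of_le_left ENNReal.toReal_nonneg
    linarith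
  have huA : spaceNorm (ρ + 2) σ T u ≤ ENNReal.ofReal A := by
    rw [← ENNReal.ofReal_toReal hu.mem.bounded.ne]
    exact ENNReal.ofReal_le_ofReal ((le_max_left _ _).trans (by linarith))
  have hvA : spaceNorm (ρ + 2) σ T' v ≤ ENNReal.ofReal A := by
    rw [← ENNReal.ofReal_toReal hv.mem.bounded.ne]
    exact ENNReal.ofReal_le_ofReal ((le_max_right _ _).trans (by linarith))
  have hF : ∀ᶠ t in 𝓝[≠] (0 : ℝ), t ≠ 0 := self_mem_nhdsWithin
  have hev := fun η (hη : 0 < η) => eventually_exists_distrBound hp0 hF hlim hη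
  have hnear : ∀ {S : ℝ≥0∞}, 0 < S → ∀ᶠ t in 𝓝[≠] (0 : ℝ), ENNReal.ofReal |t| < S := by
    intro S hS
    have h1 : Tendsto (fun t : ℝ => ENNReal.ofReal |t|) (𝓝[≠] 0) (𝓝 0) := by
      have := ((ENNReal.continuous_ofReal.comp continuous_abs).tendsto (0 : ℝ)).mono_left
        (nhdsWithin_le_nhds (s := {0}ᶜ))
      simpa using! this
    exact h1.eventually_lt_const hS
  obtain ⟨r, hr, hgood⟩ := eventually_punctured_nhds_zero.1
    ((hnear hT).and ((hnear hT').and ((hnear one_pos).and (hev 1 one_pos))))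
  have htT : ∀ t : ℝ, t ≠ 0 → |t| ≤ r → t ∈ times T := fun t ht htr => ⟨ht, (hgood t ht htr).1⟩
  have htT' : ∀ t : ℝ, t ≠ 0 → |t| ≤ r → t ∈ times T' :=
    fun t ht htr => ⟨ht, (hgood t ht htr).2.1⟩
  have ht1 : ∀ t : ℝ, t ≠ 0 → |t| ≤ r → |t| ≤ 1 := fun t ht htr => by
    have := (hgood t ht htr).2.2.1
    rw [← ENNReal.ofReal_one, ENNReal.ofReal_lt_ofReal_iff one_pos] at this
    exact this.le
  have hub : ∀ s : ℝ, s ≠ 0 → |s| ≤ r → DistrBound (ρ + 2) (A * |s| ^ (-σ)) (u s) :=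
    fun s hs hsr => distrBound_of_spaceNorm_le hp0 hA0.le huA (htT s hs hsr)
  have hvb : ∀ s : ℝ, s ≠ 0 → |s| ≤ r → DistrBound (ρ + 2) (A * |s| ^ (-σ)) (v s) :=
    fun s hs hsr => distrBound_of_spaceNorm_le hp0 hA0.le hvA (htT' s hs hsr)
  -- One use of the integral inequality improves the exponent `h'` by `δ`; `h' > -δ` is precisely
  -- the integrability condition `σρ + (σ - h') < 1`.
  have hstep : ∀ h' : ℝ, -δ < h' → ∃ M : ℝ, 0 < M ∧ ∀ t : ℝ, t ≠ 0 → |t| ≤ r →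
      ∀ K L : ℝ, 0 < K → 0 < L →
      (∃ w : Space n → ℂ, AEStronglyMeasurable w volume ∧
        Represents (distSchrodinger t (φ - φ')) w ∧
        DistrBound (ρ + 2) (L * |t| ^ (-(σ - h))) w) →
      (∀ s : ℝ, s ≠ 0 → |s| ≤ r → DistrBound (ρ + 2) (K * |s| ^ (-(σ - h')))
        fun x => u s x - v s x) →
      DistrBound (ρ + 2) (M * K * |t| ^ (-(σ - (h' + δ))) + 2 * L * |t| ^ (-(σ - h)))
        fun x => u t x - v t x := by
    intro h' hh'
    have hCpos := duhamelConst_pos hρ lam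
    have hβ := betaInt_nonneg σ (σ * ρ + (σ - h'))
    refine ⟨2 * (duhamelConst ρ lam * A ^ ρ * (betaInt σ (σ * ρ + (σ - h')) + 1)),
      by positivity, ?_⟩
    rintro t ht htr K L hK hL ⟨w, hwm, hw, hwL⟩ hD
    have ht0 := abs_pos.2 ht
    have hμ : σ * ρ + (σ - h') < 1 := by rw [hδ] at hh'; linarith
    have := hu.distrBound_sub hρ hv (htT t ht htr) (htT' t ht htr) hwm hw (by positivity) hwL hA0
      hK le_rfl hσ hμ hμ (fun s hs hst => hub s hs (hst.trans htr))
      (fun s hs hst => hvb s hs (hst.trans htr))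
      (fun s hs hst => by rw [zero_mul, add_zero]; exact hD s hs (hst.trans htr))
    rw [← hσdef, show 1 - σ - (σ * ρ + (σ - h')) = -(σ - (h' + δ)) by rw [hδ]; ring] at this
    convert this using 1
    ring
  -- Membership in the solution spaces gives exponent `0`, so the iteration starts at `min h 0`. The
  -- cap at `h` reflects the linear part, which is no better than that. Since `|t| ≤ 1`, lowering
  -- the exponent only weakens a bound.
  have hiter : ∀ k : ℕ, ∃ K : ℝ, 0 < K ∧ ∀ s : ℝ, s ≠ 0 → |s| ≤ r →
      DistrBound (ρ + 2) (K * |s| ^ (-(σ - min h (min h 0 + k * δ))))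
        fun x => u s x - v s x := by
    intro k
    induction k with
    | zero =>
      refine ⟨4 * A, by positivity, fun s hs hsr => ?_⟩
      have hs0 := abs_pos.2 hs
      refine ((hub s hs hsr).sub_same hp.le (by positivity) (hvb s hs hsr)).mono hp0.le
        (by positivity) ?_
      rw [← mul_assoc]
      refine mul_le_mul_of_nonneg_left
        (Real.rpow_le_rpow_of_exponent_ge hs0 (ht1 s hs hsr) ?_) (by positivity)
      have h1 : min h (min h 0 + ((0 : ℕ) : ℝ) * δ) ≤ 0 := by simp
      linarith
    | succ k ih =>
      obtain ⟨K, hK, hKb⟩ := ih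
      set h' := min h (min h 0 + k * δ) with hh'
      have hkδ : 0 ≤ k * δ := by positivity
      have hh'δ : -δ < h' := by
        refine lt_min hh ?_
        have : -δ < min h 0 := lt_min hh (by linarith)
        linarith
      obtain ⟨M, hM, hMb⟩ := hstep h' hh'δ
      refine ⟨M * K + 2, by positivity, fun t ht htr => ?_⟩
      have ht0 := abs_pos.2 ht
      refine (hMb t ht htr K 1 hK one_pos (hgood t ht htr).2.2.2 hKb).mono hp0.le
        (by positivity) ?_
      set h'' := min h (min h 0 + ((k + 1 : ℕ) : ℝ) * δ) with hh''
      have e1 : h'' ≤ h := min_le_left _ _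
      have e2 : h'' ≤ h' + δ := by
        rw [hh', min_add]
        refine le_min (by linarith) ((min_le_right _ _).trans (le_of_eq ?_))
        push_cast
        ring
      rw [add_mul, mul_one]
      refine add_le_add ?_ ?_
      · exact mul_le_mul_of_nonneg_left
          (Real.rpow_le_rpow_of_exponent_ge ht0 (ht1 t ht htr) (by linarith)) (by positivity)
      · exact mul_le_mul_of_nonneg_left
          (Real.rpow_le_rpow_of_exponent_ge ht0 (ht1 t ht htr) (by linarith)) (by positivity)
  obtain ⟨K, hK, hKb⟩ : ∃ K : ℝ, 0 < K ∧ ∀ s : ℝ, s ≠ 0 → |s| ≤ r →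
      DistrBound (ρ + 2) (K * |s| ^ (-(σ - h))) fun x => u s x - v s x := by
    obtain ⟨k, hk⟩ := exists_nat_gt ((h - min h 0) / δ)
    rw [div_lt_iff₀ hδ0] at hk
    have := hiter k
    rwa [min_eq_left (by linarith : h ≤ min h 0 + k * δ)] at this
  -- A step beyond `h` gives the Duhamel term a spare factor `|t|^δ → 0`; what remains is the linear
  -- part, small by hypothesis.
  obtain ⟨M, hM, hMb⟩ := hstep h hh
  refine tendsto_weakNorm_of_distrBound hp hF fun η hη => ?_
  have htail : ∀ᶠ t in 𝓝[≠] (0 : ℝ), M * K * |t| ^ δ < η / 2 := by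
    have hcont : Continuous fun t : ℝ => M * K * |t| ^ δ :=
      continuous_const.mul ((Real.continuous_rpow_const hδ0.le).comp continuous_abs)
    have h1 := (hcont.tendsto 0).mono_left (nhdsWithin_le_nhds (s := {0}ᶜ))
    rw [abs_zero, Real.zero_rpow hδ0.ne', mul_zero] at h1
    exact h1.eventually_lt_const (by positivity)
  have hclose : ∀ᶠ t in 𝓝[≠] (0 : ℝ), t ≠ 0 ∧ |t| ≤ r :=
    eventually_punctured_nhds_zero.2 ⟨r, hr, fun t ht htr => ⟨ht, htr⟩⟩
  filter_upwards [hclose, htail, hev (η / 4) (by positivity)] with t htr htl hw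
  have ht0 := abs_pos.2 htr.1
  refine (hMb t htr.1 htr.2 K (η / 4) hK (by positivity) hw hKb).mono hp0.le (by positivity) ?_
  rw [show -(σ - (h + δ)) = δ + -(σ - h) by ring, Real.rpow_add ht0, ← mul_assoc, ← add_mul]
  gcongr
  linarith

end NLS

end

theorem theorem2p3 (n : ℕ) (hn : 0 < n) (ρ : ℝ) (hρ : 0 < ρ) (lam : ℂ) :
    -- asymptotic stability of global solutions
    ((ρ + 2) / (ρ + 1) < n * ρ / 2 → n * ρ / 2 < ρ + 2 →
      ∀ h : ℝ, 0 ≤ h → h < 1 - NLS.alpha n ρ / 2 * (ρ + 1) →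
      ∃ ε₀ : ℝ, 0 < ε₀ ∧ ∀ ε : ℝ, 0 < ε → ε ≤ ε₀ →
      ∀ (φ φ' : 𝓢'(NLS.Space n, ℂ)) (u v : ℝ → NLS.Space n → ℂ),
        NLS.IsSmallGlobalSolution ρ lam ε φ u → NLS.IsSmallGlobalSolution ρ lam ε φ' v →
        Tendsto (fun t : ℝ => ENNReal.ofReal (|t| ^ (NLS.alpha n ρ / 2 + h)) *
          NLS.distWeakNorm (ρ + 2) (NLS.distSchrodinger t (φ - φ')))
          (comap (fun t : ℝ => |t|) atTop) (𝓝 0) →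
        Tendsto (fun t : ℝ => ENNReal.ofReal (|t| ^ (NLS.alpha n ρ / 2 + h)) *
          NLS.weakNorm (ρ + 2) (fun x => u t x - v t x))
          (comap (fun t : ℝ => |t|) atTop) (𝓝 0)) ∧
    -- behaviour of local solutions near `t = 0`
    (n * ρ / 2 < (ρ + 2) / (ρ + 1) →
      ∀ h : ℝ, -(1 - (NLS.alpha n ρ - NLS.beta n ρ) / 2 * (ρ + 1)) < h →
      ∀ (T T' : ℝ≥0∞), 0 < T → 0 < T' →
      ∀ (φ φ' : 𝓢'(NLS.Space n, ℂ)) (u v : ℝ → NLS.Space n → ℂ),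
        NLS.IsLocalSolution ρ lam T φ u → NLS.IsLocalSolution ρ lam T' φ' v →
        Tendsto (fun t : ℝ => ENNReal.ofReal (|t| ^ ((NLS.alpha n ρ - NLS.beta n ρ) / 2 - h)) *
          NLS.distWeakNorm (ρ + 2) (NLS.distSchrodinger t (φ - φ')))
          (𝓝[≠] 0) (𝓝 0) →
        Tendsto (fun t : ℝ => ENNReal.ofReal (|t| ^ ((NLS.alpha n ρ - NLS.beta n ρ) / 2 - h)) *
          NLS.weakNorm (ρ + 2) (fun x => u t x - v t x))
          (𝓝[≠] 0) (𝓝 0)) := by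
  refine ⟨fun _ h₂ h hh hh1 => NLS.asymptotic_stability hρ lam h₂ hh hh1, ?_⟩
  intro h₁ h hh T T' hT hT' φ φ' u v hu hv hlim
  exact NLS.behaviour_at_zero hρ h₁ hh hT hT' hu.mild hv.mild hlim
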